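/- Let $d\ge 2$ be an integer. For a finite set $\mathcal X\subset\mathbb R^d$ whose points have distinct $d$-th coordinates, the South minimal directed spanning tree (MDST) joins each point $x\in\mathcal X$, other than the one with the smallest $d$-th coordinate, by an edge to a Euclidean-nearest point among the points of $\mathcal X\setminus\{x\}$ whose $d$-th coordinate is at most that of $x$; let $\mathcal L^d_{\max}(\mathcal X)$ be the length of its longest edge. For a finite sequence $(y_1,\dots,y_m)$ in $\mathbb R^{d-1}$, the on-line nearest-neighbour graph (ONG) joins each $y_i$, $2\le i\le m$, to a nearest point among $y_1,\dots,y_{i-1}$; let $$\mathcal O^{d-1}_{\max}(y_1,\dots,y_m)=\max_{2\le i\le m}\ \min_{1\le j<i}\|y_i-y_j\|$$ be the length of its longest edge. (A longest edge length is $0$ if there are no edges.) The max-Dickman distribution is the law of a real random variable $M$ satisfying $M\overset{d}{=}\max\{1-U,UM\}$, where $U$ is uniform on $(0,1)$ and independent of the $M$ on the right; exactly one probability law on $\mathbb R$ has this property. There exists a random variable $Q_{\max}(d-1)$, whose law depends only on $d$, such that the following hold. 1. If $\mathcal P_n$ is a homogeneous Poisson point process of intensity $n$ on $(0,1)^d$,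 then $\mathcal L^d_{\max}(\mathcal P_n)\overset{d}{\longrightarrow}Q_{\max}(d-1)$ as $n\to\infty$. 2. $Q_{\max}(d-1)$ is the limit of the longest edge of the ONG in dimension $d-1$: if $U_1,U_2,\dots$ are independent uniform random vectors in $(0,1)^{d-1}$ and $N(n)$ is a Poisson random variable with mean $n$, independent of $(U_1,U_2,\dots)$, then, as $n\to\infty$, $\mathcal O^{d-1}_{\max}(U_1,\dots,U_n)\overset{d}{\longrightarrow}Q_{\max}(d-1)$ and $\mathcal O^{d-1}_{\max}(U_1,\dots,U_{N(n)})\overset{d}{\longrightarrow}Q_{\max}(d-1)$. 3. If $d=2$, then $Q_{\max}(1)\overset{d}{=}\max\{UM_1,(1-U)M_2\}$, where $U,M_1,M_2$ are independent, $U$ is uniform on $(0,1)$, and $M_1,M_2$ have the max-Dickman distribution. -/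

import Mathlib

open MeasureTheory ProbabilityTheory Filter Topology
open scoped NNReal ENNReal

namespace SouthMDST

/-- The open unit cube `(0,1)^d`. -/
def openCube (d : ℕ) : Set (EuclideanSpace ℝ (Fin d)) :=
  {x | ∀ i, x i ∈ Set.Ioo (0 : ℝ) 1}

/-- The uniform distribution on `(0,1)^d`: Lebesgue measure restricted to the open unit cube,
which has total mass `1`. -/
noncomputable def uniformCube (d : ℕ) : Measure (EuclideanSpace ℝ (Fin d)) :=
  volume.restrict (openCube d)

/-- The uniform distribution on `(0,1)`. -/
noncomputable def uniform01 : Measure ℝ := volume.restrict (Set.Ioo (0 : ℝ) 1)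

/-- The number of points of the finite set `X` that lie in `A`. -/
noncomputable def count {E : Type*} (X : Finset E) (A : Set E) : ℕ :=
  ((X : Set E) ∩ A).ncard

/-- `P` is a homogeneous Poisson point process of intensity `r` on `(0,1)^d`: a random finite
subset of the cube such that the number of points in a Borel set `A` is Poisson distributed with
mean `r` times the volume of `A ∩ (0,1)^d`, and the numbers of points in finitely many pairwise
disjoint Borel sets are independent. -/
structure IsPoissonProcess {d : ℕ} (r : ℝ≥0) {Ω : Type*} [MeasurableSpace Ω]
    (P : Ω → Finset (EuclideanSpace ℝ (Fin d))) (μ : Measure Ω) : Prop where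
  subset_cube : ∀ ω, (P ω : Set (EuclideanSpace ℝ (Fin d))) ⊆ openCube d
  measurable_count : ∀ A, MeasurableSet A → Measurable fun ω => count (P ω) A
  map_count : ∀ A, MeasurableSet A →
    μ.map (fun ω => count (P ω) A) = poissonMeasure (r * (uniformCube d A).toNNReal)
  indep_count : ∀ (m : ℕ) (A : Fin m → Set (EuclideanSpace ℝ (Fin d))),
    (∀ i, MeasurableSet (A i)) → Pairwise (fun i j => Disjoint (A i) (A j)) →
      iIndepFun (fun i ω => count (P ω) (A i)) μ

open scoped Classical in
/-- The points of `X` other than `x` that precede `x` in the South order, i.e. whose last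
coordinate is at most that of `x`. The ambient dimension is `k + 1`. -/
noncomputable def southPreds {k : ℕ} (X : Finset (EuclideanSpace ℝ (Fin (k + 1))))
    (x : EuclideanSpace ℝ (Fin (k + 1))) : Finset (EuclideanSpace ℝ (Fin (k + 1))) :=
  X.filter fun z => z ≠ x ∧ z (Fin.last k) ≤ x (Fin.last k)

open scoped Classical in
/-- The length of the edge of the South minimal directed spanning tree on `X` that leaves `x`: the
Euclidean distance from `x` to a directed nearest neighbour, and `0` if `x` is the sink. -/
noncomputable def southDist {k : ℕ} (X : Finset (EuclideanSpace ℝ (Fin (k + 1))))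
    (x : EuclideanSpace ℝ (Fin (k + 1))) : ℝ :=
  if h : (southPreds X x).Nonempty then (southPreds X x).inf' h fun z => ‖z - x‖ else 0

open scoped Classical in
/-- The length of the longest edge of the South minimal directed spanning tree on `X`
(`0` if there is no edge). -/
noncomputable def southLongestEdge {k : ℕ} (X : Finset (EuclideanSpace ℝ (Fin (k + 1)))) : ℝ :=
  if h : X.Nonempty then X.sup' h (southDist X) else 0

open scoped Classical in
/-- The length of the edge of the on-line nearest-neighbour graph on the sequence
`y 0, y 1, …` that leaves `y i`: the distance from `y i` to the nearest of `y 0, …, y (i - 1)`, and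
`0` if `i = 0`. -/
noncomputable def ongDist {d : ℕ} (y : ℕ → EuclideanSpace ℝ (Fin d)) (i : ℕ) : ℝ :=
  if h : (Finset.range i).Nonempty then (Finset.range i).inf' h fun j => ‖y i - y j‖ else 0

open scoped Classical in
/-- The length of the longest edge of the on-line nearest-neighbour graph on the sequence
`y 0, …, y (m - 1)` of `m` points (`0` if there is no edge). -/
noncomputable def ongLongestEdge {d : ℕ} (y : ℕ → EuclideanSpace ℝ (Fin d)) (m : ℕ) : ℝ :=
  if h : (Finset.range m).Nonempty then (Finset.range m).sup' h (ongDist y) else 0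

/-- `D` is a max-Dickman distribution: if `M` has law `D` and `U` is uniform on `(0,1)` and
independent of `M`, then `max {1 - U, U M}` again has law `D`. -/
def IsMaxDickman (D : ProbabilityMeasure ℝ) : Prop :=
  (uniform01.prod (D : Measure ℝ)).map (fun p : ℝ × ℝ => max (1 - p.1) (p.1 * p.2)) =
    (D : Measure ℝ)

end SouthMDST

/-!
The law of the longest edge of the South MDST is determined by the void probabilities of the
Poisson process (Rényi), so the process may be replaced by a Poisson number of independent uniform
points. Taken in the order of their last coordinate, these project to independent uniform points
of `(0,1)^k`, and once every cell of a fine grid is occupied the longest edge of the South MDST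
differs little from that of the ONG on the projections. The longest edge of the ONG increases with
the number of points, so it converges to its supremum, whose law is the limit `Q`.

In dimension one, the edge of a point that falls between two earlier points is no longer than the
earlier edge that first passed over it, so only the two outer gaps matter. Giving each of them an
independent max-Dickman variable, scaled to its length, as a further edge produces a random variable
whose law does not change when the next point arrives: this is the max-Dickman equation. With one
point it is `max {U M₁, (1 - U) M₂}`, and as the number of points grows it tends to the supremum
of the ONG.
-/

namespace SouthMDST

section DirectedLongestEdge

variable {ι κ V W : Type*} [PseudoMetricSpace V] [PseudoMetricSpace W]

/-- The length of the longest edge of the graph that joins each `z i` to a nearest point among the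
`z j` with `r j i`. Both the South tree and the on-line nearest-neighbour graph are of this form.
The conventions `⨅ i : Empty, f i = 0` and `⨆ i : Empty, f i = 0` give length `0` to missing
edges. -/
noncomputable def directedLongestEdge (r : ι → ι → Prop) (z : ι → V) : ℝ :=
  ⨆ i, ⨅ j : {j // r j i}, dist (z i) (z j)

theorem directedLongestEdge_nonneg (r : ι → ι → Prop) (z : ι → V) :
    0 ≤ directedLongestEdge r z :=
  Real.iSup_nonneg fun _ => Real.iInf_nonneg fun _ => dist_nonneg

theorem directedLongestEdge_le_iff [Finite ι] (r : ι → ι → Prop) (z : ι → V) {t : ℝ}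
    (ht : 0 ≤ t) :
    directedLongestEdge r z ≤ t ↔ ∀ i, (∃ j, r j i) → ∃ j, r j i ∧ dist (z i) (z j) ≤ t := by
  have hinf (i : ι) : ⨅ j : {j // r j i}, dist (z i) (z j) ≤ t ↔
      ((∃ j, r j i) → ∃ j, r j i ∧ dist (z i) (z j) ≤ t) := by
    rcases isEmpty_or_nonempty {j // r j i} with h | h
    · have h' : ¬ ∃ j, r j i := fun ⟨j, hj⟩ => h.false ⟨j, hj⟩
      simp only [Real.iInf_of_isEmpty, ht, h', false_imp_iff]
    · refine ⟨fun hle _ => ?_, fun hex => ?_⟩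
      · obtain ⟨⟨j, hj⟩, hmin⟩ :=
          exists_eq_ciInf_of_finite (f := fun j : {j // r j i} => dist (z i) (z j))
        exact ⟨j, hj, hmin.trans_le hle⟩
      · obtain ⟨j, hj, hle⟩ := hex ⟨h.some, h.some.2⟩
        exact (ciInf_le (Set.finite_range _).bddBelow (⟨j, hj⟩ : {j // r j i})).trans hle
  simp only [← hinf]
  exact ⟨fun h i => (le_ciSup (Set.finite_range _).bddAbove i).trans h, fun h => Real.iSup_le h ht⟩

theorem exists_dist_le_directedLongestEdge [Finite ι] {r : ι → ι → Prop} (z : ι → V) {i : ι}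
    (h : ∃ j, r j i) : ∃ j, r j i ∧ dist (z i) (z j) ≤ directedLongestEdge r z :=
  (directedLongestEdge_le_iff r z (directedLongestEdge_nonneg r z)).1 le_rfl i h

theorem directedLongestEdge_comp_equiv (r : ι → ι → Prop) (z : ι → V) (e : κ ≃ ι) :
    directedLongestEdge (fun j i => r (e j) (e i)) (z ∘ e) = directedLongestEdge r z := by
  unfold directedLongestEdge
  rw [← e.iSup_comp]
  exact iSup_congr fun i =>
    Equiv.iInf_congr (e.subtypeEquiv (p := fun j => r (e j) (e i)) fun _ => Iff.rfl) fun _ => rfl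

theorem directedLongestEdge_le_add [Finite ι] {r : ι → ι → Prop} {z : ι → V} {w : ι → W} {c : ℝ}
    (hc : 0 ≤ c) (h : ∀ i, (∃ j, r j i ∧ dist (z i) (z j) ≤ c) ∨
      ∀ j, r j i → dist (z i) (z j) ≤ dist (w i) (w j) + c) :
    directedLongestEdge r z ≤ directedLongestEdge r w + c := by
  have hw := directedLongestEdge_nonneg r w
  rw [directedLongestEdge_le_iff r z (by positivity)]
  intro i hi
  rcases h i with ⟨j, hj, hjc⟩ | hle
  · exact ⟨j, hj, by linarith⟩
  · obtain ⟨j, hj, hjw⟩ := exists_dist_le_directedLongestEdge w hi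
    exact ⟨j, hj, by linarith [hle j hj]⟩

theorem lipschitzWith_directedLongestEdge [Fintype ι] (r : ι → ι → Prop) :
    LipschitzWith 2 (directedLongestEdge r : (ι → V) → ℝ) := by
  refine LipschitzWith.of_le_add_mul 2 fun z w =>
    directedLongestEdge_le_add (by positivity) fun i => .inr fun j _ => ?_
  have h := dist_triangle4 (z i) (w i) (w j) (z j)
  have hi := dist_le_pi_dist z w i
  have hj := dist_le_pi_dist w z j
  rw [dist_comm w z] at hj
  push_cast
  linarith

theorem measurable_directedLongestEdge {α : Type*} [MeasurableSpace α] [MeasurableSpace V]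
    [OpensMeasurableSpace V] [SecondCountableTopology V] [Finite ι] {r : α → ι → ι → Prop}
    {z : α → ι → V} (hr : ∀ i j, MeasurableSet {a | r a j i}) (hz : ∀ i, Measurable (z · i)) :
    Measurable fun a => directedLongestEdge (r a) (z a) := by
  refine measurable_of_Iic fun t => ?_
  rcases lt_or_ge t 0 with ht | ht
  · convert MeasurableSet.empty
    ext a
    simpa using ht.trans_le (directedLongestEdge_nonneg (r a) (z a))
  · have hset : (fun a => directedLongestEdge (r a) (z a)) ⁻¹' Set.Iic t =
        {a | ∀ i, (∃ j, r a j i) → ∃ j, r a j i ∧ dist (z a i) (z a j) ≤ t} := by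
      ext a
      exact directedLongestEdge_le_iff _ _ ht
    rw [hset]
    simp only [Set.ofPred_forall]
    refine MeasurableSet.iInter fun i => MeasurableSet.imp ?_ ?_ <;>
      simp only [Set.ofPred_exists]
    · exact MeasurableSet.iUnion fun j => hr i j
    · exact MeasurableSet.iUnion fun j =>
        (hr i j).inter (measurableSet_le ((hz i).dist (hz j)) measurable_const)

end DirectedLongestEdge

section SouthTree

variable {k : ℕ} (X : Finset (EuclideanSpace ℝ (Fin (k + 1))))

theorem southDist_nonneg (x : EuclideanSpace ℝ (Fin (k + 1))) : 0 ≤ southDist X x := by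
  unfold southDist
  split_ifs
  · exact Finset.le_inf' _ _ fun _ _ => norm_nonneg _
  · exact le_rfl

theorem southDist_le_iff (x : EuclideanSpace ℝ (Fin (k + 1))) {t : ℝ} (ht : 0 ≤ t) :
    southDist X x ≤ t ↔
      ((southPreds X x).Nonempty → ∃ z ∈ southPreds X x, ‖z - x‖ ≤ t) := by
  unfold southDist
  split_ifs with h
  · simp only [Finset.inf'_le_iff, h, true_imp_iff]
  · simp only [ht, h, false_imp_iff]

theorem southLongestEdge_nonneg : 0 ≤ southLongestEdge X := by
  unfold southLongestEdge
  split_ifs with h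
  · exact (southDist_nonneg X h.choose).trans (Finset.le_sup' _ h.choose_spec)
  · exact le_rfl

theorem southLongestEdge_le_iff {t : ℝ} (ht : 0 ≤ t) :
    southLongestEdge X ≤ t ↔
      ∀ x ∈ X, (southPreds X x).Nonempty → ∃ z ∈ southPreds X x, ‖z - x‖ ≤ t := by
  unfold southLongestEdge
  split_ifs with h
  · simp only [Finset.sup'_le_iff, southDist_le_iff X _ ht]
  · simp only [ht, Finset.not_nonempty_iff_eq_empty.1 h, Finset.notMem_empty, false_imp_iff,
      implies_true]

theorem southLongestEdge_image {ι : Type*} [Fintype ι]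
    [DecidableEq (EuclideanSpace ℝ (Fin (k + 1)))] {Z : ι → EuclideanSpace ℝ (Fin (k + 1))}
    (hZ : Function.Injective Z) :
    southLongestEdge (Finset.univ.image Z) =
      directedLongestEdge (fun j i => j ≠ i ∧ Z j (Fin.last k) ≤ Z i (Fin.last k)) Z := by
  have hle {t : ℝ} (ht : 0 ≤ t) : southLongestEdge (Finset.univ.image Z) ≤ t ↔
      directedLongestEdge (fun j i => j ≠ i ∧ Z j (Fin.last k) ≤ Z i (Fin.last k)) Z ≤ t := by
    rw [southLongestEdge_le_iff _ ht, directedLongestEdge_le_iff _ _ ht]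
    simp only [southPreds, Finset.Nonempty, Finset.mem_filter, Finset.mem_image, Finset.mem_univ,
      true_and, exists_exists_eq_and, forall_exists_index, forall_apply_eq_imp_iff, hZ.ne_iff,
      dist_eq_norm', and_assoc]
  exact le_antisymm ((hle (directedLongestEdge_nonneg _ _)).2 le_rfl)
    ((hle (southLongestEdge_nonneg _)).1 le_rfl)

end SouthTree

section OnlineNearestNeighbour

variable {d : ℕ} (y : ℕ → EuclideanSpace ℝ (Fin d))

theorem ongDist_nonneg (i : ℕ) : 0 ≤ ongDist y i := by
  unfold ongDist
  split_ifs
  · exact Finset.le_inf' _ _ fun _ _ => norm_nonneg _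
  · exact le_rfl

theorem ongDist_le_iff (i : ℕ) {t : ℝ} (ht : 0 ≤ t) :
    ongDist y i ≤ t ↔ (0 < i → ∃ j < i, ‖y i - y j‖ ≤ t) := by
  unfold ongDist
  split_ifs with h
  · have hi : 0 < i := by simpa [Nat.pos_iff_ne_zero] using h
    simp only [Finset.inf'_le_iff, Finset.mem_range, hi, true_imp_iff]
  · have hi : i = 0 := by simpa using h
    simp only [ht, hi, lt_irrefl, false_imp_iff]

theorem ongLongestEdge_nonneg (m : ℕ) : 0 ≤ ongLongestEdge y m := by
  unfold ongLongestEdge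
  split_ifs with h
  · exact (ongDist_nonneg y h.choose).trans (Finset.le_sup' _ h.choose_spec)
  · exact le_rfl

theorem ongLongestEdge_le_iff_forall_ongDist_le (m : ℕ) {t : ℝ} (ht : 0 ≤ t) :
    ongLongestEdge y m ≤ t ↔ ∀ i < m, ongDist y i ≤ t := by
  unfold ongLongestEdge
  split_ifs with h
  · simp only [Finset.sup'_le_iff, Finset.mem_range]
  · have hm : m = 0 := by simpa using h
    simp only [ht, hm, not_lt_zero, false_imp_iff, implies_true]

theorem ongLongestEdge_le_iff (m : ℕ) {t : ℝ} (ht : 0 ≤ t) :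
    ongLongestEdge y m ≤ t ↔ ∀ i < m, 0 < i → ∃ j < i, ‖y i - y j‖ ≤ t := by
  simp only [ongLongestEdge_le_iff_forall_ongDist_le y m ht, ongDist_le_iff y _ ht]

theorem ongLongestEdge_eq_directedLongestEdge (m : ℕ) :
    ongLongestEdge y m = directedLongestEdge (fun j i : Fin m => j < i) fun i => y i := by
  have hle {t : ℝ} (ht : 0 ≤ t) : ongLongestEdge y m ≤ t ↔
      directedLongestEdge (fun j i : Fin m => j < i) (fun i => y i) ≤ t := by
    rw [ongLongestEdge_le_iff y m ht, directedLongestEdge_le_iff _ _ ht, Fin.forall_iff]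
    refine forall₂_congr fun i hi => imp_congr ⟨fun h => ⟨⟨0, h.trans hi⟩, h⟩, ?_⟩ ⟨?_, ?_⟩
    · rintro ⟨j, hj⟩
      exact j.1.zero_le.trans_lt hj
    · rintro ⟨j, hj, hle⟩
      exact ⟨⟨j, hj.trans hi⟩, hj, dist_eq_norm (y i) (y j) ▸ hle⟩
    · rintro ⟨j, hj, hle⟩
      exact ⟨j, hj, dist_eq_norm (y i) (y j) ▸ hle⟩
  exact le_antisymm ((hle (directedLongestEdge_nonneg _ _)).2 le_rfl)
    ((hle (ongLongestEdge_nonneg _ _)).1 le_rfl)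

theorem measurable_ongLongestEdge (m : ℕ) :
    Measurable fun y : ℕ → EuclideanSpace ℝ (Fin d) => ongLongestEdge y m := by
  simp only [ongLongestEdge_eq_directedLongestEdge]
  exact measurable_directedLongestEdge (fun _ _ => .const _) fun i => measurable_pi_apply _

theorem ongLongestEdge_mono : Monotone (ongLongestEdge y) := fun m n hmn => by
  rw [ongLongestEdge_le_iff_forall_ongDist_le y m (ongLongestEdge_nonneg y n)]
  exact fun i hi => (ongLongestEdge_le_iff_forall_ongDist_le y n (ongLongestEdge_nonneg y n)).1
    le_rfl i (hi.trans_le hmn)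

theorem norm_le_mul_of_forall_abs_le (v : EuclideanSpace ℝ (Fin d)) {c : ℝ}
    (h : ∀ i, |v i| ≤ c) : ‖v‖ ≤ d * c := by
  calc ‖v‖ = ‖∑ i, EuclideanSpace.single i (v i)‖ := by
        congr 1; ext j; simp
    _ ≤ ∑ i, ‖EuclideanSpace.single i (v i)‖ := norm_sum_le _ _
    _ ≤ ∑ _i : Fin d, c := Finset.sum_le_sum fun i _ => by
        simpa only [EuclideanSpace.single, PiLp.norm_single, Real.norm_eq_abs] using h i
    _ = d * c := by simp

theorem ongLongestEdge_le_of_mem_openCube {y : ℕ → EuclideanSpace ℝ (Fin d)}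
    (hy : ∀ i, y i ∈ openCube d) (m : ℕ) : ongLongestEdge y m ≤ d := by
  rw [ongLongestEdge_le_iff y m (by positivity)]
  refine fun i _ hi => ⟨0, hi, ?_⟩
  refine (norm_le_mul_of_forall_abs_le (c := 1) _ fun l => ?_).trans_eq (mul_one _)
  rw [PiLp.sub_apply, abs_le]
  constructor <;> linarith [(hy i l).1, (hy i l).2, (hy 0 l).1, (hy 0 l).2]

end OnlineNearestNeighbour

section VoidProbabilities

variable {E Ω Ω' ι : Type*}

/-- The event that the random finite set `P` has no point in `B`. -/
def voidEvent (P : Ω → Finset E) (B : Set E) : Set Ω :=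
  {ω | ∀ x ∈ P ω, x ∉ B}

theorem isPiSystem_range_Iic_finset (ι : Type*) :
    IsPiSystem (Set.range (Set.Iic : Finset ι → Set (Finset ι))) := by
  classical
  rintro _ ⟨s, rfl⟩ _ ⟨t, rfl⟩ _
  exact ⟨s ⊓ t, Set.Iic_inter_Iic.symm⟩

theorem generateFrom_range_Iic_finset (ι : Type*) [Countable ι] :
    MeasurableSpace.generateFrom (Set.range (Set.Iic : Finset ι → Set (Finset ι))) = ⊤ := by
  classical
  refine top_unique fun 𝒮 _ => ?_
  let m := MeasurableSpace.generateFrom (Set.range (Set.Iic : Finset ι → Set (Finset ι)))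
  have hIic (s : Finset ι) : MeasurableSet[m] (Set.Iic s) :=
    MeasurableSpace.measurableSet_generateFrom ⟨s, rfl⟩
  have hsingleton (s : Finset ι) : MeasurableSet[m] {s} := by
    have : ({s} : Set (Finset ι)) = Set.Iic s \ ⋃ t ∈ s.ssubsets, Set.Iic t := by
      ext u
      simp only [Set.mem_singleton_iff, Set.mem_sdiff, Set.mem_Iic, Set.mem_iUnion,
        Finset.mem_ssubsets, exists_prop, not_exists, not_and]
      refine ⟨?_, fun ⟨hu, h⟩ => by_contra fun hne => h u (lt_of_le_of_ne hu hne) le_rfl⟩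
      rintro rfl
      exact ⟨le_rfl, fun t ht hle => ht.not_ge hle⟩
    rw [this]
    exact (hIic s).diff (.biUnion (Finset.countable_toSet _) fun t _ => hIic t)
  exact @MeasurableSet.of_discrete _ m (@DiscreteMeasurableSpace.mk _ m fun 𝒯 =>
    𝒯.biUnion_of_singleton ▸ .biUnion 𝒯.to_countable fun s _ => hsingleton s) 𝒮

theorem image_preimage_Iic [DecidableEq ι] (P : Ω → Finset E) (φ : E → ι) (s : Finset ι) :
    (fun ω => (P ω).image φ) ⁻¹' Set.Iic s = voidEvent P (φ ⁻¹' sᶜ) := by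
  ext ω
  simp only [voidEvent, Set.mem_preimage, Set.mem_Iic, Finset.image_subset_iff, Set.mem_compl_iff,
    Finset.mem_coe, not_not, Set.mem_ofPred_eq]

variable [MeasurableSpace E] [MeasurableSpace Ω] [MeasurableSpace Ω'] [MeasurableSpace ι]
  [DiscreteMeasurableSpace ι] [Countable ι] [DecidableEq ι] {μ : Measure Ω} {μ' : Measure Ω'}
  {P : Ω → Finset E} {P' : Ω' → Finset E}

theorem measurableSet_image_mem (hP : ∀ B, MeasurableSet B → MeasurableSet (voidEvent P B))
    {φ : E → ι} (hφ : Measurable φ) (𝒮 : Set (Finset ι)) :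
    MeasurableSet ((fun ω => (P ω).image φ) ⁻¹' 𝒮) := by
  let mι : MeasurableSpace (Finset ι) := .generateFrom (Set.range Set.Iic)
  have hm : Measurable fun ω => (P ω).image φ := by
    refine measurable_generateFrom ?_
    rintro _ ⟨s, rfl⟩
    rw [image_preimage_Iic]
    exact hP _ (hφ .of_discrete)
  exact hm ((generateFrom_range_Iic_finset ι).ge 𝒮 trivial)

/-- Rényi's theorem for random subsets of a countable set: void probabilities determine the law. -/
theorem measure_image_mem_eq [IsFiniteMeasure μ]
    (hP : ∀ B, MeasurableSet B → MeasurableSet (voidEvent P B))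
    (hP' : ∀ B, MeasurableSet B → MeasurableSet (voidEvent P' B))
    (h : ∀ B, MeasurableSet B → μ (voidEvent P B) = μ' (voidEvent P' B))
    {φ : E → ι} (hφ : Measurable φ) (𝒮 : Set (Finset ι)) :
    μ ((fun ω => (P ω).image φ) ⁻¹' 𝒮) = μ' ((fun ω => (P' ω).image φ) ⁻¹' 𝒮) := by
  let mι : MeasurableSpace (Finset ι) := ⊤
  have hm : Measurable fun ω => (P ω).image φ := fun 𝒯 _ => measurableSet_image_mem hP hφ 𝒯
  have hm' : Measurable fun ω => (P' ω).image φ := fun 𝒯 _ => measurableSet_image_mem hP' hφ 𝒯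
  suffices hmap : μ.map (fun ω => (P ω).image φ) = μ'.map (fun ω => (P' ω).image φ) by
    rw [← Measure.map_apply hm trivial, hmap, Measure.map_apply hm' trivial]
  refine ext_of_generate_finite _ (generateFrom_range_Iic_finset ι).symm
    (isPiSystem_range_Iic_finset ι) ?_ ?_
  · rintro _ ⟨s, rfl⟩
    rw [Measure.map_apply hm trivial, Measure.map_apply hm' trivial, image_preimage_Iic,
      image_preimage_Iic, h _ (hφ .of_discrete)]
  · rw [Measure.map_apply hm .univ, Measure.map_apply hm' .univ]
    simpa [voidEvent] using h ∅ .empty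

variable {F : Finset E → ℝ} {φ : ℕ → E → ι} {G : ℕ → Finset ι → ℝ}

theorem measurable_comp_of_tendsto_image
    (hP : ∀ B, MeasurableSet B → MeasurableSet (voidEvent P B)) (hφ : ∀ M, Measurable (φ M))
    (hF : ∀ X, Tendsto (fun M => G M (X.image (φ M))) atTop (𝓝 (F X))) :
    Measurable fun ω => F (P ω) :=
  measurable_of_tendsto_metrizable
    (fun M A _ => measurableSet_image_mem hP (hφ M) (G M ⁻¹' A))
    (tendsto_pi_nhds.2 fun ω => hF (P ω))

theorem map_comp_eq_of_tendsto_image [IsProbabilityMeasure μ] [IsProbabilityMeasure μ']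
    (hP : ∀ B, MeasurableSet B → MeasurableSet (voidEvent P B))
    (hP' : ∀ B, MeasurableSet B → MeasurableSet (voidEvent P' B))
    (h : ∀ B, MeasurableSet B → μ (voidEvent P B) = μ' (voidEvent P' B))
    (hφ : ∀ M, Measurable (φ M))
    (hF : ∀ X, Tendsto (fun M => G M (X.image (φ M))) atTop (𝓝 (F X))) :
    μ.map (fun ω => F (P ω)) = μ'.map (fun ω => F (P' ω)) := by
  have hm (M : ℕ) : Measurable fun ω => G M ((P ω).image (φ M)) :=
    fun A _ => measurableSet_image_mem hP (hφ M) (G M ⁻¹' A)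
  have hm' (M : ℕ) : Measurable fun ω => G M ((P' ω).image (φ M)) :=
    fun A _ => measurableSet_image_mem hP' (hφ M) (G M ⁻¹' A)
  have hmap (M : ℕ) : μ.map (fun ω => G M ((P ω).image (φ M))) =
      μ'.map (fun ω => G M ((P' ω).image (φ M))) := by
    ext A hA
    rw [Measure.map_apply (hm M) hA, Measure.map_apply (hm' M) hA]
    exact measure_image_mem_eq hP hP' h (hφ M) (G M ⁻¹' A)
  have hlim := tendstoInDistribution_of_ae_tendsto (μ' := μ)
    (X := fun M ω => G M ((P ω).image (φ M))) (Z := fun ω => F (P ω)) (fun M => (hm M).aemeasurable)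
    (measurable_comp_of_tendsto_image hP hφ hF).aemeasurable (.of_forall fun ω => hF (P ω))
  have hlim' := tendstoInDistribution_of_ae_tendsto (μ' := μ')
    (X := fun M ω => G M ((P' ω).image (φ M))) (Z := fun ω => F (P' ω))
    (fun M => (hm' M).aemeasurable)
    (measurable_comp_of_tendsto_image hP' hφ hF).aemeasurable (.of_forall fun ω => hF (P' ω))
  have heq := tendsto_nhds_unique (X := ProbabilityMeasure ℝ) hlim.tendsto
    (hlim'.tendsto.congr fun M => Subtype.ext (hmap M).symm)
  exact congrArg Subtype.val heq

end VoidProbabilities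

section GridRounding

variable {d : ℕ} (M : ℕ)

/-- The integer coordinates of the cube of side `1 / (M + 1)` that contains `x`. -/
noncomputable def gridIndex (x : EuclideanSpace ℝ (Fin d)) : Fin d → ℤ :=
  fun i => ⌊(M + 1) * x i⌋

/-- The lowest corner of the cube of side `1 / (M + 1)` with integer coordinates `c`. -/
noncomputable def gridPoint (c : Fin d → ℤ) : EuclideanSpace ℝ (Fin d) :=
  WithLp.toLp 2 fun i => c i / (M + 1)

theorem measurable_gridIndex : Measurable (gridIndex (d := d) M) :=
  measurable_pi_lambda _ fun i => Int.measurable_floor.comp (by fun_prop)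

theorem gridPoint_gridIndex_le_of_le {x y : EuclideanSpace ℝ (Fin d)} {i : Fin d}
    (h : x i ≤ y i) : gridPoint M (gridIndex M x) i ≤ gridPoint M (gridIndex M y) i := by
  simp only [gridPoint, gridIndex]
  gcongr

theorem abs_sub_gridPoint_gridIndex_le (x : EuclideanSpace ℝ (Fin d)) (i : Fin d) :
    |gridPoint M (gridIndex M x) i - x i| ≤ 1 / (M + 1) := by
  have hM : (0 : ℝ) < M + 1 := by positivity
  simp only [gridPoint, gridIndex]
  rw [div_sub' hM.ne', abs_div, abs_of_pos hM, abs_sub_comm]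
  gcongr
  rw [Int.self_sub_floor, Int.abs_fract]
  exact (Int.fract_lt_one _).le

theorem tendsto_gridPoint_gridIndex (x : EuclideanSpace ℝ (Fin d)) :
    Tendsto (fun M => gridPoint M (gridIndex M x)) atTop (𝓝 x) := by
  refine tendsto_iff_norm_sub_tendsto_zero.2 (squeeze_zero (fun _ => norm_nonneg _)
    (fun M => norm_le_mul_of_forall_abs_le _ (abs_sub_gridPoint_gridIndex_le M x)) ?_)
  simpa only [mul_zero] using tendsto_one_div_add_atTop_nhds_zero_nat.const_mul (d : ℝ)

end GridRounding

section VoidProbabilitiesOfSouthTree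

variable {k : ℕ}

theorem eventually_injective_of_tendsto {ι α E : Type*} [Finite α] [TopologicalSpace E] [T2Space E]
    {l : Filter ι} {f : α → E} (hf : Function.Injective f) {g : ι → α → E}
    (hg : ∀ x, Tendsto (g · x) l (𝓝 (f x))) : ∀ᶠ i in l, Function.Injective (g i) := by
  refine (eventually_all.2 fun x => eventually_all.2 fun y => ?_ :
    ∀ᶠ i in l, ∀ x y, g i x = g i y → x = y)
  by_cases hxy : x = y
  · exact .of_forall fun _ _ => hxy
  · filter_upwards [((hg x).prodMk_nhds (hg y)).eventually
      (isClosed_diagonal.isOpen_compl.mem_nhds (hf.ne hxy))] with i hi h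
    exact absurd h hi

theorem tendsto_southLongestEdge_image [DecidableEq (EuclideanSpace ℝ (Fin (k + 1)))]
    {g : ℕ → EuclideanSpace ℝ (Fin (k + 1)) → EuclideanSpace ℝ (Fin (k + 1))}
    (hg : ∀ x, Tendsto (g · x) atTop (𝓝 x))
    (hmono : ∀ M x y, x (Fin.last k) ≤ y (Fin.last k) → g M x (Fin.last k) ≤ g M y (Fin.last k))
    (X : Finset (EuclideanSpace ℝ (Fin (k + 1)))) :
    Tendsto (fun M => southLongestEdge (X.image (g M))) atTop (𝓝 (southLongestEdge X)) := by
  let r (j i : X) : Prop := j ≠ i ∧ j.1 (Fin.last k) ≤ i.1 (Fin.last k)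
  have hX : southLongestEdge X = directedLongestEdge r Subtype.val := by
    simpa only [Finset.univ_eq_attach, Finset.attach_image_val] using
      southLongestEdge_image (Subtype.val_injective (p := (· ∈ X)))
  have hinj := eventually_injective_of_tendsto (Subtype.val_injective (p := (· ∈ X)))
    fun x => hg x.1
  have hlast : ∀ᶠ M in atTop, ∀ x y : X,
      (g M x (Fin.last k) ≤ g M y (Fin.last k) ↔ x.1 (Fin.last k) ≤ y.1 (Fin.last k)) := by
    refine eventually_all.2 fun x => eventually_all.2 fun y => ?_
    rcases le_or_gt (x.1 (Fin.last k)) (y.1 (Fin.last k)) with hxy | hxy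
    · exact .of_forall fun M => iff_of_true (hmono M x y hxy) hxy
    · have hcoord (z : EuclideanSpace ℝ (Fin (k + 1))) :
          Tendsto (fun M => g M z (Fin.last k)) atTop (𝓝 (z (Fin.last k))) :=
        ((EuclideanSpace.proj (𝕜 := ℝ) (Fin.last k)).continuous.tendsto z).comp (hg z)
      filter_upwards [(hcoord y).eventually_lt (hcoord x) hxy] with M hM
      exact iff_of_false hM.not_ge hxy.not_ge
  have hev : ∀ᶠ M in atTop, southLongestEdge (X.image (g M)) =
      directedLongestEdge r fun x : X => g M x := by
    filter_upwards [hinj, hlast] with M hinj hlast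
    have h := southLongestEdge_image hinj
    simp only [hlast] at h
    rw [← h]
    congr 1
    ext
    simp
  rw [hX]
  exact ((lipschitzWith_directedLongestEdge r).continuous.tendsto _ |>.comp
    (tendsto_pi_nhds.2 fun x => hg x.1)).congr' (hev.mono fun _ h => h.symm)

/-- `P` has the void probabilities of a Poisson process of intensity `r` on `(0,1)^d`: it avoids
`B` with probability `exp (-r |B ∩ (0,1)^d|)`, written here as the Poisson probability of `0`. -/
structure HasPoissonVoidProbabilities {d : ℕ} (r : ℝ≥0) {Ω : Type*} [MeasurableSpace Ω]
    (P : Ω → Finset (EuclideanSpace ℝ (Fin d))) (μ : Measure Ω) : Prop where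
  measurableSet_voidEvent : ∀ B, MeasurableSet B → MeasurableSet (voidEvent P B)
  measure_voidEvent : ∀ B, MeasurableSet B →
    μ (voidEvent P B) = poissonMeasure (r * (uniformCube d B).toNNReal) {0}

theorem voidEvent_eq_preimage_count {E Ω : Type*} (P : Ω → Finset E) (B : Set E) :
    voidEvent P B = (fun ω => count (P ω) B) ⁻¹' {0} := by
  ext ω
  simp only [voidEvent, Set.mem_ofPred_eq, Set.mem_preimage, Set.mem_singleton_iff, count]
  rw [Set.ncard_eq_zero ((P ω).finite_toSet.inter_of_left B), Set.eq_empty_iff_forall_notMem]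
  simp only [Set.mem_inter_iff, Finset.mem_coe, not_and]

theorem IsPoissonProcess.hasPoissonVoidProbabilities {d : ℕ} {r : ℝ≥0} {Ω : Type*}
    [MeasurableSpace Ω] {P : Ω → Finset (EuclideanSpace ℝ (Fin d))} {μ : Measure Ω}
    (hP : IsPoissonProcess r P μ) : HasPoissonVoidProbabilities r P μ where
  measurableSet_voidEvent B hB := by
    rw [voidEvent_eq_preimage_count]
    exact hP.measurable_count B hB (measurableSet_singleton 0)
  measure_voidEvent B hB := by
    rw [voidEvent_eq_preimage_count, ← hP.map_count B hB,
      Measure.map_apply (hP.measurable_count B hB) (measurableSet_singleton 0)]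

variable {r : ℝ≥0} {Ω Ω' : Type*} [MeasurableSpace Ω] [MeasurableSpace Ω'] {μ : Measure Ω}
  {μ' : Measure Ω'} {P : Ω → Finset (EuclideanSpace ℝ (Fin (k + 1)))}
  {P' : Ω' → Finset (EuclideanSpace ℝ (Fin (k + 1)))}

open scoped Classical in
theorem tendsto_southLongestEdge_image_gridPoint (X : Finset (EuclideanSpace ℝ (Fin (k + 1)))) :
    Tendsto (fun M => southLongestEdge ((X.image (gridIndex M)).image (gridPoint M))) atTop
      (𝓝 (southLongestEdge X)) := by
  simp only [Finset.image_image]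
  exact tendsto_southLongestEdge_image (g := fun M x => gridPoint M (gridIndex M x))
    tendsto_gridPoint_gridIndex (fun M _ _ => gridPoint_gridIndex_le_of_le M) X

theorem HasPoissonVoidProbabilities.measurable_southLongestEdge
    (hP : HasPoissonVoidProbabilities r P μ) : Measurable fun ω => southLongestEdge (P ω) := by
  classical
  exact measurable_comp_of_tendsto_image (φ := gridIndex)
    (G := fun M Y => southLongestEdge (Y.image (gridPoint M))) hP.measurableSet_voidEvent
    measurable_gridIndex tendsto_southLongestEdge_image_gridPoint

theorem HasPoissonVoidProbabilities.map_southLongestEdge_eq [IsProbabilityMeasure μ]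
    [IsProbabilityMeasure μ'] (hP : HasPoissonVoidProbabilities r P μ)
    (hP' : HasPoissonVoidProbabilities r P' μ') :
    μ.map (fun ω => southLongestEdge (P ω)) = μ'.map (fun ω => southLongestEdge (P' ω)) := by
  classical
  exact map_comp_eq_of_tendsto_image (φ := gridIndex)
    (G := fun M Y => southLongestEdge (Y.image (gridPoint M)))
    hP.measurableSet_voidEvent hP'.measurableSet_voidEvent
    (fun B hB => (hP.measure_voidEvent B hB).trans (hP'.measure_voidEvent B hB).symm)
    measurable_gridIndex tendsto_southLongestEdge_image_gridPoint

end VoidProbabilitiesOfSouthTree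

section ConvergingTogether

variable {ι E : Type*} [PseudoMetricSpace E] [MeasurableSpace E] [BorelSpace E]

theorem levyProkhorovDist_map_le {Ω : Type*} [MeasurableSpace Ω] {μ : Measure Ω}
    [IsProbabilityMeasure μ] {X Y : Ω → E} (hX : AEMeasurable X μ) (hY : AEMeasurable Y μ) {ε : ℝ}
    (hε : 0 ≤ ε) (h : μ {ω | ε < dist (X ω) (Y ω)} ≤ ENNReal.ofReal ε) :
    levyProkhorovDist (μ.map X) (μ.map Y) ≤ ε := by
  have := Measure.isProbabilityMeasure_map hX
  have := Measure.isProbabilityMeasure_map hY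
  refine levyProkhorovDist_le_of_forall_le _ _ hε fun δ B hδ hB => ?_
  have hsub : X ⁻¹' B ⊆ Y ⁻¹' Metric.thickening δ B ∪ {ω | ε < dist (X ω) (Y ω)} := by
    intro ω hω
    refine or_iff_not_imp_right.2 fun hle => Metric.mem_thickening_iff.2 ⟨X ω, hω, ?_⟩
    rw [dist_comm]
    exact (not_lt.1 hle).trans_lt hδ
  rw [Measure.map_apply_of_aemeasurable hX hB,
    Measure.map_apply_of_aemeasurable hY Metric.isOpen_thickening.measurableSet]
  calc μ (X ⁻¹' B)
      ≤ μ (Y ⁻¹' Metric.thickening δ B) + μ {ω | ε < dist (X ω) (Y ω)} :=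
        (measure_mono hsub).trans (measure_union_le _ _)
    _ ≤ μ (Y ⁻¹' Metric.thickening δ B) + ENNReal.ofReal δ := by
        gcongr
        exact h.trans (ENNReal.ofReal_le_ofReal hδ.le)

/-- Unlike in `tendstoInDistribution_of_tendstoInMeasure_sub`, the probability space may vary and
the filter is arbitrary. -/
theorem tendstoInDistribution_of_tendsto_measure_lt_dist [TopologicalSpace.SeparableSpace E]
    {l : Filter ι} {Ω : ι → Type*} [∀ i, MeasurableSpace (Ω i)] {μ : ∀ i, Measure (Ω i)}
    [∀ i, IsProbabilityMeasure (μ i)] {Ω' : Type*} [MeasurableSpace Ω'] {ν : Measure Ω'}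
    [IsProbabilityMeasure ν] {X Y : ∀ i, Ω i → E} {Z : Ω' → E}
    (hX : ∀ i, AEMeasurable (X i) (μ i)) (hY : TendstoInDistribution Y l Z μ ν)
    (h : ∀ ε, 0 < ε → Tendsto (fun i => μ i {ω | ε < dist (X i ω) (Y i ω)}) l (𝓝 0)) :
    TendstoInDistribution X l Z μ ν := by
  refine ⟨hX, hY.aemeasurable_limit, ?_⟩
  have hYlim := (LevyProkhorov.continuous_ofMeasure_probabilityMeasure.tendsto _).comp hY.tendsto
  refine (LevyProkhorov.continuous_toMeasure_probabilityMeasure.tendsto _).comp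
    (tendsto_of_tendsto_of_dist hYlim (Metric.tendsto_nhds.2 fun ε hε => ?_))
  have hε2 : 0 < ENNReal.ofReal (ε / 2) := by simpa using half_pos hε
  filter_upwards [(h _ (half_pos hε)).eventually_le_const hε2] with i hi
  rw [Real.dist_0_eq_abs, abs_of_nonneg dist_nonneg]
  simp only [dist_comm (X i _)] at hi
  exact (levyProkhorovDist_map_le (hY.forall_aemeasurable i) (hX i) (half_pos hε).le hi).trans_lt
    (half_lt_self hε)

theorem tendstoInDistribution_of_map_eq {l : Filter ι} {Ω : ι → Type*}
    [∀ i, MeasurableSpace (Ω i)] {μ : ∀ i, Measure (Ω i)} [∀ i, IsProbabilityMeasure (μ i)]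
    {Ω' : ι → Type*} [∀ i, MeasurableSpace (Ω' i)] {μ' : ∀ i, Measure (Ω' i)}
    [∀ i, IsProbabilityMeasure (μ' i)] {Ω'' : Type*} [MeasurableSpace Ω''] {ν : Measure Ω''}
    [IsProbabilityMeasure ν] {X : ∀ i, Ω i → E} {Y : ∀ i, Ω' i → E} {Z : Ω'' → E}
    (hX : ∀ i, AEMeasurable (X i) (μ i)) (hY : TendstoInDistribution Y l Z μ' ν)
    (h : ∀ i, (μ i).map (X i) = (μ' i).map (Y i)) : TendstoInDistribution X l Z μ ν :=
  ⟨hX, hY.aemeasurable_limit, hY.tendsto.congr fun i => Subtype.ext (h i).symm⟩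

theorem tendstoInDistribution_of_hasLaw {l : Filter ι} {Ω : ι → Type*}
    [∀ i, MeasurableSpace (Ω i)] {μ : ∀ i, Measure (Ω i)} [∀ i, IsProbabilityMeasure (μ i)]
    {Q : ProbabilityMeasure E} {X : ∀ i, Ω i → E} (hX : ∀ i, HasLaw (X i) (Q : Measure E) (μ i)) :
    TendstoInDistribution X l (fun q => q) μ (Q : Measure E) where
  forall_aemeasurable i := (hX i).aemeasurable
  aemeasurable_limit := aemeasurable_id
  tendsto := tendsto_const_nhds.congr fun i =>
    Subtype.ext (Measure.map_id.trans (hX i).map_eq.symm)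

end ConvergingTogether

section UniformSequences

instance isProbabilityMeasure_uniform01 : IsProbabilityMeasure uniform01 :=
  ⟨by simp [uniform01]⟩

theorem openCube_eq_preimage (d : ℕ) :
    openCube d = (WithLp.ofLp : EuclideanSpace ℝ (Fin d) → Fin d → ℝ) ⁻¹'
      (Set.univ.pi fun _ => Set.Ioo (0 : ℝ) 1) := by
  ext x
  simp only [openCube, Set.mem_ofPred_eq, Set.mem_preimage, Set.mem_univ_pi]

theorem measurableSet_openCube (d : ℕ) : MeasurableSet (openCube d) := by
  rw [openCube_eq_preimage]
  exact ((isOpen_set_pi Set.finite_univ fun _ _ => isOpen_Ioo).preimage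
    (PiLp.continuous_ofLp 2 _)).measurableSet

instance isProbabilityMeasure_uniformCube (d : ℕ) : IsProbabilityMeasure (uniformCube d) := by
  constructor
  rw [uniformCube, Measure.restrict_apply_univ, openCube_eq_preimage,
    (PiLp.volume_preserving_ofLp (Fin d)).measure_preimage
      (MeasurableSet.univ_pi fun _ => measurableSet_Ioo).nullMeasurableSet, volume_pi_pi]
  simp only [Real.volume_Ioo, sub_zero, ENNReal.ofReal_one, Finset.prod_const_one]

theorem ae_mem_openCube (d : ℕ) : ∀ᵐ x ∂uniformCube d, x ∈ openCube d :=
  ae_restrict_mem (measurableSet_openCube d)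

theorem ae_infinitePi_forall_mem {ι α : Type*} [Countable ι] [MeasurableSpace α] {ν : Measure α}
    [IsProbabilityMeasure ν] {s : Set α} (hs : ∀ᵐ x ∂ν, x ∈ s) :
    ∀ᵐ y ∂Measure.infinitePi (fun _ : ι => ν), ∀ i, y i ∈ s :=
  ae_all_iff.2 fun i =>
    (measurePreserving_eval_infinitePi (fun _ : ι => ν) i).quasiMeasurePreserving.ae hs

/-- The law of a sequence of independent uniform points of `(0,1)^k`. -/
noncomputable def uniformSeq (k : ℕ) : Measure (ℕ → EuclideanSpace ℝ (Fin k)) :=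
  Measure.infinitePi fun _ : ℕ => uniformCube k

instance isProbabilityMeasure_uniformSeq (k : ℕ) : IsProbabilityMeasure (uniformSeq k) := by
  unfold uniformSeq; infer_instance

theorem ae_uniformSeq_mem_openCube (k : ℕ) : ∀ᵐ y ∂uniformSeq k, ∀ i, y i ∈ openCube k :=
  ae_infinitePi_forall_mem (ae_mem_openCube k)

end UniformSequences

section OngLimit

variable {k : ℕ}

/-- The supremum of the edge lengths of the on-line nearest-neighbour graph on a whole sequence
(the junk value `0` if they are unbounded). -/
noncomputable def ongSup (y : ℕ → EuclideanSpace ℝ (Fin k)) : ℝ :=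
  ⨆ m, ongLongestEdge y m

theorem measurable_ongSup : Measurable (ongSup : (ℕ → EuclideanSpace ℝ (Fin k)) → ℝ) :=
  Measurable.iSup measurable_ongLongestEdge

variable {y : ℕ → EuclideanSpace ℝ (Fin k)}

theorem bddAbove_range_ongLongestEdge (hy : ∀ i, y i ∈ openCube k) :
    BddAbove (Set.range (ongLongestEdge y)) :=
  ⟨k, Set.forall_mem_range.2 (ongLongestEdge_le_of_mem_openCube hy)⟩

theorem tendsto_ongLongestEdge (hy : ∀ i, y i ∈ openCube k) :
    Tendsto (ongLongestEdge y) atTop (𝓝 (ongSup y)) :=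
  tendsto_atTop_ciSup (ongLongestEdge_mono y) (bddAbove_range_ongLongestEdge hy)

theorem dist_ongLongestEdge_ongSup_anti (hy : ∀ i, y i ∈ openCube k) {m n : ℕ} (hmn : m ≤ n) :
    dist (ongLongestEdge y n) (ongSup y) ≤ dist (ongLongestEdge y m) (ongSup y) := by
  have hm := ongLongestEdge_mono y hmn
  have hn := le_ciSup (bddAbove_range_ongLongestEdge hy) n
  exact Real.dist_right_le_of_mem_uIcc (Set.mem_uIcc_of_le hm hn)

variable (k) in
/-- The law of the supremum of the edge lengths of the on-line nearest-neighbour graph on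
independent uniform points of `(0,1)^k`, which is the law of `Q_max(k)`. -/
noncomputable def ongSupLaw : ProbabilityMeasure ℝ :=
  ⟨(uniformSeq k).map ongSup, Measure.isProbabilityMeasure_map measurable_ongSup.aemeasurable⟩

theorem measurable_ongLongestEdge_uncurry :
    Measurable fun p : ℕ × (ℕ → EuclideanSpace ℝ (Fin k)) => ongLongestEdge p.2 p.1 :=
  measurable_from_prod_countable_right measurable_ongLongestEdge

variable {ι : Type*} {l : Filter ι} {Ω : ι → Type*} [∀ i, MeasurableSpace (Ω i)]
  {μ : ∀ i, Measure (Ω i)} {U : ∀ i, Ω i → ℕ → EuclideanSpace ℝ (Fin k)}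
  {N : ∀ i, Ω i → ℕ}

theorem tendsto_measure_lt_dist_ongLongestEdge_ongSup {ε : ℝ} (hε : 0 < ε)
    (hU : ∀ i, HasLaw (U i) (uniformSeq k) (μ i))
    (hN : ∀ m, Tendsto (fun i => μ i {ω | N i ω < m}) l (𝓝 0)) :
    Tendsto (fun i => μ i {ω | ε < dist (ongLongestEdge (U i ω) (N i ω)) (ongSup (U i ω))}) l
      (𝓝 0) := by
  let A (m : ℕ) : Set (ℕ → EuclideanSpace ℝ (Fin k)) :=
    {y | ε < dist (ongLongestEdge y m) (ongSup y)}
  have hA (m : ℕ) : MeasurableSet (A m) :=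
    measurableSet_lt measurable_const ((measurable_ongLongestEdge m).dist measurable_ongSup)
  have hlim : Tendsto (fun m => uniformSeq k (A m)) atTop (𝓝 0) := by
    have hae := (ae_uniformSeq_mem_openCube k).mono fun y hy => tendsto_ongLongestEdge hy
    have hmeas := tendstoInMeasure_iff_dist.1 (tendstoInMeasure_of_tendsto_ae
      (fun m => (measurable_ongLongestEdge m).aestronglyMeasurable) hae) ε hε
    exact tendsto_of_tendsto_of_tendsto_of_le_of_le tendsto_const_nhds hmeas (fun _ => zero_le)
      fun m => measure_mono <| Set.ofPred_subset_ofPred.2 fun _ => le_of_lt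
  have hle (m : ℕ) (i : ι) :
      μ i {ω | ε < dist (ongLongestEdge (U i ω) (N i ω)) (ongSup (U i ω))} ≤
        μ i {ω | N i ω < m} + uniformSeq k (A m) := by
    rw [← (hU i).map_eq, Measure.map_apply_of_aemeasurable (hU i).aemeasurable (hA m)]
    refine (measure_mono_ae ?_).trans (measure_union_le _ _)
    have hcube := ae_of_ae_map (hU i).aemeasurable
      ((hU i).map_eq ▸ ae_uniformSeq_mem_openCube k)
    filter_upwards [hcube] with ω hω hlt
    exact (lt_or_ge (N i ω) m).imp_right fun h =>
      hlt.trans_le (dist_ongLongestEdge_ongSup_anti hω h)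
  refine ENNReal.tendsto_nhds_zero.2 fun δ hδ => ?_
  obtain ⟨m, hm⟩ := ((ENNReal.tendsto_nhds_zero.1 hlim) (δ / 2) (ENNReal.half_pos hδ.ne')).exists
  filter_upwards [ENNReal.tendsto_nhds_zero.1 (hN m) (δ / 2) (ENNReal.half_pos hδ.ne')] with i hi
  exact (hle m i).trans ((add_le_add hi hm).trans_eq (ENNReal.add_halves δ))

theorem tendstoInDistribution_ongLongestEdge [∀ i, IsProbabilityMeasure (μ i)]
    (hU : ∀ i, HasLaw (U i) (uniformSeq k) (μ i))
    (hNm : ∀ i, AEMeasurable (N i) (μ i))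
    (hN : ∀ m, Tendsto (fun i => μ i {ω | N i ω < m}) l (𝓝 0)) :
    TendstoInDistribution (fun i ω => ongLongestEdge (U i ω) (N i ω)) l (fun q : ℝ => q) μ
      (ongSupLaw k : Measure ℝ) := by
  have hsup : HasLaw ongSup (ongSupLaw k : Measure ℝ) (uniformSeq k) :=
    ⟨measurable_ongSup.aemeasurable, rfl⟩
  refine tendstoInDistribution_of_tendsto_measure_lt_dist (fun i =>
    measurable_ongLongestEdge_uncurry.comp_aemeasurable ((hNm i).prodMk (hU i).aemeasurable))
    (tendstoInDistribution_of_hasLaw fun i => hsup.comp (hU i)) fun ε hε => ?_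
  exact tendsto_measure_lt_dist_ongLongestEdge_ongSup hε hU hN

theorem tendsto_poissonMeasure_Iio (m : ℕ) :
    Tendsto (fun r : ℝ≥0 => poissonMeasure r (Set.Iio m)) atTop (𝓝 0) := by
  have hsingle (j : ℕ) : Tendsto (fun r : ℝ≥0 => poissonMeasure r {j}) atTop (𝓝 0) := by
    simp only [poissonMeasure_singleton]
    have h := ((Real.tendsto_pow_mul_exp_neg_atTop_nhds_zero j).comp
      (NNReal.tendsto_coe_atTop.2 tendsto_id)).div_const (j.factorial : ℝ)
    rw [zero_div] at h
    rw [← ENNReal.ofReal_zero]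
    exact ENNReal.tendsto_ofReal (h.congr fun r => by simp [mul_comm])
  have hsum := tendsto_finsetSum (Finset.range m) fun j _ => hsingle j
  simpa only [Finset.sum_const_zero, sum_measure_singleton, Finset.coe_range] using hsum

end OngLimit

section SplitLastCoordinate

variable {k : ℕ}

/-- Splits off the last coordinate of a point of `ℝ^(k+1)`. -/
noncomputable def splitLast (x : EuclideanSpace ℝ (Fin (k + 1))) : EuclideanSpace ℝ (Fin k) × ℝ :=
  (WithLp.toLp 2 (Fin.init x.ofLp), x (Fin.last k))

theorem splitLast_mem_openCube_prod_Ioo_iff (x : EuclideanSpace ℝ (Fin (k + 1))) :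
    splitLast x ∈ openCube k ×ˢ Set.Ioo (0 : ℝ) 1 ↔ x ∈ openCube (k + 1) :=
  (Fin.forall_fin_succ' (P := fun i => x i ∈ Set.Ioo (0 : ℝ) 1)).symm

theorem dist_sq_eq_dist_splitLast (x y : EuclideanSpace ℝ (Fin (k + 1))) :
    dist x y ^ 2 = dist (splitLast x).1 (splitLast y).1 ^ 2 +
      dist (splitLast x).2 (splitLast y).2 ^ 2 := by
  simp only [EuclideanSpace.dist_sq_eq, Fin.sum_univ_castSucc, splitLast, Fin.init]

theorem dist_fst_splitLast_le (x y : EuclideanSpace ℝ (Fin (k + 1))) :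
    dist (splitLast x).1 (splitLast y).1 ≤ dist x y := by
  refine le_of_sq_le_sq ?_ dist_nonneg
  rw [dist_sq_eq_dist_splitLast x y]
  exact le_add_of_nonneg_right (sq_nonneg _)

theorem dist_le_dist_splitLast_add (x y : EuclideanSpace ℝ (Fin (k + 1))) :
    dist x y ≤ dist (splitLast x).1 (splitLast y).1 + dist (splitLast x).2 (splitLast y).2 := by
  refine le_of_sq_le_sq ?_ (by positivity)
  rw [dist_sq_eq_dist_splitLast x y]
  nlinarith [mul_nonneg (dist_nonneg (x := (splitLast x).1) (y := (splitLast y).1))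
    (dist_nonneg (x := (splitLast x).2) (y := (splitLast y).2))]

variable (k) in
theorem measurePreserving_splitLast_volume :
    MeasurePreserving (splitLast (k := k)) volume (volume.prod volume) := by
  have hsplit := (Measure.measurePreserving_swap.comp <| (MeasurePreserving.id volume).prod
      (PiLp.volume_preserving_toLp (Fin k))).comp <|
    (volume_preserving_piFinSuccAbove (fun _ : Fin (k + 1) => ℝ) (Fin.last k)).comp
      (PiLp.volume_preserving_ofLp (Fin (k + 1)))
  have heq : splitLast (k := k) = (Prod.swap ∘ Prod.map id (WithLp.toLp 2)) ∘
      MeasurableEquiv.piFinSuccAbove (fun _ : Fin (k + 1) => ℝ) (Fin.last k) ∘ WithLp.ofLp := by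
    ext x : 1
    simp [splitLast, MeasurableEquiv.piFinSuccAbove, Fin.insertNthEquiv]
  rwa [heq]

variable (k) in
theorem measurePreserving_splitLast :
    MeasurePreserving (splitLast (k := k)) (uniformCube (k + 1))
      ((uniformCube k).prod uniform01) := by
  have h := (measurePreserving_splitLast_volume k).restrict_preimage
    ((measurableSet_openCube k).prod (measurableSet_Ioo (a := (0 : ℝ)) (b := 1)))
  rwa [show splitLast ⁻¹' openCube k ×ˢ Set.Ioo (0 : ℝ) 1 = openCube (k + 1) from
    Set.ext splitLast_mem_openCube_prod_Ioo_iff, ← Measure.prod_restrict] at h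

end SplitLastCoordinate

section InfiniteProducts

variable {α β : Type*} [MeasurableSpace α] [MeasurableSpace β] {ν : Measure α} {ρ : Measure β}
  [IsProbabilityMeasure ν]

variable (ν ρ) in
theorem measurePreserving_infinitePi_prodMk [IsProbabilityMeasure ρ] (ι : Type*) :
    MeasurePreserving (fun (p : (ι → β) × (ι → α)) i => (p.2 i, p.1 i))
      ((Measure.infinitePi fun _ => ρ).prod (Measure.infinitePi fun _ => ν))
      (Measure.infinitePi fun _ => ν.prod ρ) := by
  have hpair : Measurable fun (p : (ι → β) × (ι → α)) i => (p.2 i, p.1 i) := by fun_prop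
  refine ⟨hpair, Measure.eq_infinitePi _ fun s t ht => ?_⟩
  have hslice (i : ι) : Measurable fun b => ν ((·, b) ⁻¹' t i) :=
    measurable_measure_prodMk_right (ht i)
  have hbox : MeasurableSet (Set.pi s t) := .pi s.countable_toSet fun i _ => ht i
  have hind : iIndepFun (fun i (T : ι → β) => ν ((·, T i) ⁻¹' t i))
      (Measure.infinitePi fun _ : ι => ρ) :=
    iIndepFun_infinitePi (X := fun i b => ν ((·, b) ⁻¹' t i)) hslice
  calc _ = ∫⁻ T : ι → β, Measure.infinitePi (fun _ : ι => ν)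
          (Set.pi s fun i => (·, T i) ⁻¹' t i) ∂Measure.infinitePi fun _ => ρ := by
        rw [Measure.map_apply hpair hbox, Measure.prod_apply (hpair hbox)]
        rfl
    _ = ∫⁻ T : ι → β, ∏ i ∈ s, ν ((·, T i) ⁻¹' t i) ∂Measure.infinitePi fun _ => ρ :=
        lintegral_congr fun T => Measure.infinitePi_pi _ fun i _ => measurable_prodMk_right (ht i)
    _ = ∏ i ∈ s, ∫⁻ T : ι → β, ν ((·, T i) ⁻¹' t i) ∂Measure.infinitePi fun _ => ρ :=
        lintegral_prod_eq_prod_lintegral_of_indepFun s _ hind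
          fun i => (hslice i).comp (measurable_pi_apply i)
    _ = ∏ i ∈ s, ν.prod ρ (t i) := Finset.prod_congr rfl fun i _ => by
        rw [Measure.prod_apply_symm (ht i),
          ← (measurePreserving_eval_infinitePi (fun _ : ι => ρ) i).lintegral_comp (hslice i)]

theorem ae_injective_infinitePi [NullSingletonClass ν] [MeasurableSingletonClass α]
    [MeasurableEq α] {ι : Type*} [Countable ι] :
    ∀ᵐ y ∂Measure.infinitePi (fun _ : ι => ν), Function.Injective y := by
  have hdiag : ∀ᵐ p ∂ν.prod ν, p.1 ≠ p.2 := by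
    refine (Measure.ae_prod_iff_ae_ae measurableSet_diagonal.compl).2 (.of_forall fun x => ?_)
    exact (ν.ae_ne x).mono fun y hy h => hy (Set.mem_diagonal_iff.1 h).symm
  have hne : ∀ᵐ y ∂Measure.infinitePi (fun _ : ι => ν), ∀ i j, i ≠ j → y i ≠ y j := by
    simp only [ae_all_iff]
    intro i j hij
    rw [← Measure.infinitePi_map_eval_prod (P := fun _ : ι => ν) hij] at hdiag
    exact ae_of_ae_map (f := fun y : ι → α => (y i, y j)) (by fun_prop) hdiag
  exact hne.mono fun y hy i j => not_imp_not.1 (hy i j)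

theorem map_prod_eq_of_ae_map_eq {α' γ : Type*} [MeasurableSpace α'] [MeasurableSpace γ]
    {ν' : Measure α'} [IsProbabilityMeasure ν'] {F : β × α → γ} {G : β × α' → γ}
    (hF : Measurable F) (hG : Measurable G)
    (h : ∀ᵐ b ∂ρ, ν.map (fun a => F (b, a)) = ν'.map (fun a => G (b, a))) :
    (ρ.prod ν).map F = (ρ.prod ν').map G := by
  ext s hs
  rw [Measure.map_apply hF hs, Measure.map_apply hG hs, Measure.prod_apply (hF hs),
    Measure.prod_apply (hG hs)]
  refine lintegral_congr_ae (h.mono fun b hb => ?_)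
  have hFb := Measure.map_apply (μ := ν) (hF.comp (measurable_prodMk_left (x := b))) hs
  have hGb := Measure.map_apply (μ := ν') (hG.comp (measurable_prodMk_left (x := b))) hs
  exact hFb.symm.trans ((congrArg (· s) hb).trans hGb)

end InfiniteProducts

section MarkedPoints

/-- The length of the longest edge when each of the points `(z 0).1, …, (z (n - 1)).1` is joined to
a nearest one among those whose mark, the second component of `z`, is smaller. -/
noncomputable def markedLongestEdge {V : Type*} [PseudoMetricSpace V] (z : ℕ → V × ℝ) (n : ℕ) :
    ℝ :=
  directedLongestEdge (fun j i : Fin n => (z j).2 < (z i).2) fun i => (z i).1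

theorem measurable_markedLongestEdge {V : Type*} [PseudoMetricSpace V] [MeasurableSpace V]
    [OpensMeasurableSpace V] [SecondCountableTopology V] (n : ℕ) :
    Measurable fun z : ℕ → V × ℝ => markedLongestEdge z n :=
  measurable_directedLongestEdge (fun i j => measurableSet_lt (by fun_prop) (by fun_prop))
    fun i => by fun_prop

variable {k : ℕ} (ν : Measure (EuclideanSpace ℝ (Fin k))) [IsProbabilityMeasure ν]

theorem map_markedLongestEdge_of_injective {T : ℕ → ℝ} (hT : Function.Injective T) (n : ℕ) :
    (Measure.infinitePi fun _ : ℕ => ν).map (fun y => markedLongestEdge (fun i => (y i, T i)) n) =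
      (Measure.infinitePi fun _ : ℕ => ν).map fun y => ongLongestEdge y n := by
  let σ : Equiv.Perm (Fin n) := Tuple.sort fun i : Fin n => T i
  have hσ : StrictMono fun i => T (σ i) :=
    (Tuple.monotone_sort fun i : Fin n => T i).strictMono_of_injective
      (hT.comp (Fin.val_injective.comp σ.injective))
  have hsort (y : ℕ → EuclideanSpace ℝ (Fin k)) : markedLongestEdge (fun i => (y i, T i)) n =
      directedLongestEdge (fun j i : Fin n => j < i) fun i => y (σ i) := by
    rw [markedLongestEdge, ← directedLongestEdge_comp_equiv _ _ σ]
    simp only [hσ.lt_iff_lt]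
    rfl
  have hmeas : Measurable fun z : Fin n → EuclideanSpace ℝ (Fin k) =>
      directedLongestEdge (fun j i : Fin n => j < i) z :=
    measurable_directedLongestEdge (fun _ _ => .const _) measurable_pi_apply
  have hlaw {f : Fin n → ℕ} (hf : Function.Injective f) :
      (Measure.infinitePi fun _ : ℕ => ν).map
          (fun y => directedLongestEdge (fun j i : Fin n => j < i) fun i => y (f i)) =
        (Measure.infinitePi fun _ : Fin n => ν).map
          (directedLongestEdge fun j i : Fin n => j < i) := by
    rw [← Measure.map_infinitePi_infinitePi_of_inj (P := fun _ : ℕ => ν) hf,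
      Measure.map_map hmeas (by fun_prop)]
    rfl
  simp only [hsort, ongLongestEdge_eq_directedLongestEdge]
  exact (hlaw (Fin.val_injective.comp σ.injective)).trans (hlaw Fin.val_injective).symm

theorem map_markedLongestEdge (ρ : Measure ℝ) [IsProbabilityMeasure ρ] [NullSingletonClass ρ]
    (n : ℕ) :
    (Measure.infinitePi fun _ : ℕ => ν.prod ρ).map (fun z => markedLongestEdge z n) =
      (Measure.infinitePi fun _ : ℕ => ν).map fun y => ongLongestEdge y n := by
  have hpair := measurePreserving_infinitePi_prodMk ν ρ ℕ
  have hmark := (measurable_markedLongestEdge n).comp hpair.measurable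
  have hong := (measurable_ongLongestEdge (d := k) n).comp
    (measurable_snd : Measurable fun p : (ℕ → ℝ) × (ℕ → EuclideanSpace ℝ (Fin k)) => p.2)
  have heq := map_prod_eq_of_ae_map_eq (ν := Measure.infinitePi fun _ : ℕ => ν) hmark hong <|
    (ae_injective_infinitePi (ν := ρ)).mono fun T hT => map_markedLongestEdge_of_injective ν hT n
  rwa [← Measure.map_map (measurable_markedLongestEdge n) hpair.measurable, hpair.map_eq,
    ← Measure.map_map (measurable_ongLongestEdge n) measurable_snd,
    measurePreserving_snd.map_eq] at heq

end MarkedPoints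

section PoissonSample

theorem lintegral_pow_poissonMeasure (r q : ℝ≥0) :
    ∫⁻ n, (q : ℝ≥0∞) ^ n ∂poissonMeasure r = ENNReal.ofReal (Real.exp (r * (q - 1))) := by
  have hterm (n : ℕ) : (q : ℝ≥0∞) ^ n * poissonMeasure r {n} =
      ENNReal.ofReal (Real.exp (-r) * ((r * q : ℝ) ^ n / n.factorial)) := by
    rw [poissonMeasure_singleton, ← ENNReal.ofReal_coe_nnreal (p := q),
      ← ENNReal.ofReal_pow q.coe_nonneg, ← ENNReal.ofReal_mul (by positivity)]
    congr 1
    ring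
  have hsum : HasSum (fun n : ℕ => Real.exp (-r) * ((r * q : ℝ) ^ n / n.factorial))
      (Real.exp (r * (q - 1))) := by
    rw [mul_sub, mul_one, sub_eq_neg_add, Real.exp_add, Real.exp_eq_exp_ℝ]
    exact (NormedSpace.expSeries_div_hasSum_exp (r * q : ℝ)).mul_left _
  rw [lintegral_countable', tsum_congr hterm,
    ← ENNReal.ofReal_tsum_of_nonneg (fun n => by positivity) hsum.summable, hsum.tsum_eq]

theorem measurableSet_forall_lt_mem {α : Type*} [MeasurableSpace α] {C : Set α}
    (hC : MeasurableSet C) : MeasurableSet {p : ℕ × (ℕ → α) | ∀ j < p.1, p.2 j ∈ C} := by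
  have hcoord (j : ℕ) : Measurable fun p : ℕ × (ℕ → α) => p.2 j := by fun_prop
  simp only [imp_iff_not_or, Set.ofPred_forall]
  exact .iInter fun j =>
    (measurableSet_lt measurable_const measurable_fst).compl.union (hcoord j hC)

theorem poissonMeasure_prod_infinitePi_forall_lt_mem {α : Type*} [MeasurableSpace α]
    {ν : Measure α} [IsProbabilityMeasure ν] (r : ℝ≥0) {C : Set α} (hC : MeasurableSet C) :
    ((poissonMeasure r).prod (Measure.infinitePi fun _ : ℕ => ν)) {p | ∀ j < p.1, p.2 j ∈ C} =
      poissonMeasure (r * (ν Cᶜ).toNNReal) {0} := by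
  have hslice (n : ℕ) : Measure.infinitePi (fun _ : ℕ => ν) {x | ∀ j < n, x j ∈ C} =
      ((ν C).toNNReal : ℝ≥0∞) ^ n := by
    have h := Measure.infinitePi_pi (fun _ : ℕ => ν) (s := Finset.range n) (t := fun _ => C)
      fun _ _ => hC
    simpa [Set.pi, ENNReal.coe_toNNReal (measure_ne_top ν C)] using h
  have hcompl : (ν Cᶜ).toReal = 1 - (ν C).toReal := probReal_compl_eq_one_sub hC
  rw [Measure.prod_apply (measurableSet_forall_lt_mem hC)]
  refine (lintegral_congr hslice).trans ?_
  rw [lintegral_pow_poissonMeasure, poissonMeasure_singleton]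
  push_cast
  rw [hcompl, pow_zero, Nat.factorial_zero, Nat.cast_one, mul_one, div_one, ← mul_neg, neg_sub]

/-- The law of a Poisson number with mean `r` together with an independent sequence of independent
uniform points of `(0,1)^d`; the first points of the sequence, as many as the number says, form a
Poisson process. -/
noncomputable def poissonSampleLaw (d : ℕ) (r : ℝ≥0) :
    Measure (ℕ × (ℕ → EuclideanSpace ℝ (Fin d))) :=
  (poissonMeasure r).prod (uniformSeq d)

instance isProbabilityMeasure_poissonSampleLaw (d : ℕ) (r : ℝ≥0) :
    IsProbabilityMeasure (poissonSampleLaw d r) := by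
  unfold poissonSampleLaw; infer_instance

open scoped Classical in
theorem hasPoissonVoidProbabilities_poissonSampleLaw (d : ℕ) (r : ℝ≥0) :
    HasPoissonVoidProbabilities r (fun p => (Finset.range p.1).image p.2)
      (poissonSampleLaw d r) := by
  have hvoid (B : Set (EuclideanSpace ℝ (Fin d))) :
      voidEvent (fun p : ℕ × (ℕ → _) => (Finset.range p.1).image p.2) B =
        {p | ∀ j < p.1, p.2 j ∈ Bᶜ} := by
    simp only [voidEvent, Finset.forall_mem_image, Finset.mem_range, Set.mem_compl_iff]
  refine ⟨fun B hB => ?_, fun B hB => ?_⟩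
  · rw [hvoid]
    exact measurableSet_forall_lt_mem hB.compl
  · rw [hvoid, poissonSampleLaw, uniformSeq,
      poissonMeasure_prod_infinitePi_forall_lt_mem r hB.compl, compl_compl]

end PoissonSample

section Cells

variable {d k M : ℕ}

/-- The open cell with lowest corner `c / (M + 1)` of the grid of mesh `1 / (M + 1)`. -/
def openCell (c : Fin d → Fin (M + 1)) : Set (EuclideanSpace ℝ (Fin d)) :=
  {x | ∀ i, (M + 1) * x i ∈ Set.Ioo (c i : ℝ) (c i + 1)}

theorem isOpen_openCell (c : Fin d → Fin (M + 1)) : IsOpen (openCell c) := by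
  simp only [openCell, Set.ofPred_forall]
  exact isOpen_iInter_of_finite fun i => isOpen_Ioo.preimage (by fun_prop)

theorem openCell_subset_openCube (c : Fin d → Fin (M + 1)) : openCell c ⊆ openCube d := by
  intro x hx i
  have hM : (0 : ℝ) < M + 1 := by positivity
  have hc : (c i : ℝ) + 1 ≤ M + 1 := by exact_mod_cast (c i).2
  exact ⟨pos_of_mul_pos_right ((Nat.cast_nonneg _).trans_lt (hx i).1) hM.le,
    lt_of_mul_lt_mul_left (by linarith [(hx i).2]) hM.le⟩

theorem uniformCube_openCell_pos (c : Fin d → Fin (M + 1)) : 0 < uniformCube d (openCell c) := by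
  rw [uniformCube, Measure.restrict_apply (isOpen_openCell c).measurableSet,
    Set.inter_eq_left.2 (openCell_subset_openCube c)]
  refine (isOpen_openCell c).measure_pos _ ⟨WithLp.toLp 2 fun i => (c i + 1 / 2) / (M + 1),
    fun i => ?_⟩
  have hM : (M : ℝ) + 1 ≠ 0 := by positivity
  rw [PiLp.toLp_apply, mul_div_cancel₀ _ hM]
  constructor <;> linarith

theorem exists_openCell_below {x : EuclideanSpace ℝ (Fin (k + 1))} (hx : x ∈ openCube (k + 1))
    (hlast : 1 / ((M : ℝ) + 1) ≤ x (Fin.last k)) :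
    ∃ c : Fin (k + 1) → Fin (M + 1), ∀ y ∈ openCell c,
      y (Fin.last k) < x (Fin.last k) ∧ dist x y ≤ (k + 1 : ℕ) * (2 / ((M : ℝ) + 1)) := by
  have hM : (0 : ℝ) < M + 1 := by positivity
  let a (l : Fin (k + 1)) : ℕ := ⌊(M + 1) * x l⌋₊
  let b : Fin (k + 1) → ℕ := Function.update a (Fin.last k) (a (Fin.last k) - 1)
  have ha (l) : (a l : ℝ) ≤ (M + 1) * x l ∧ (M + 1) * x l < a l + 1 :=
    ⟨Nat.floor_le (mul_nonneg hM.le (hx l).1.le), Nat.lt_floor_add_one _⟩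
  have haM (l) : a l < M + 1 := by
    have := (ha l).1.trans_lt (mul_lt_of_lt_one_right hM (hx l).2)
    exact_mod_cast this
  have hpos : 1 ≤ a (Fin.last k) := Nat.le_floor (by rwa [Nat.cast_one, ← div_le_iff₀' hM])
  have hblast : b (Fin.last k) + 1 = a (Fin.last k) := by simp [b, hpos]
  have hba (l) : b l ≤ a l ∧ a l ≤ b l + 1 := by
    rcases eq_or_ne l (Fin.last k) with rfl | hl
    · omega
    · simp [b, hl]
  refine ⟨fun l => ⟨b l, (hba l).1.trans_lt (haM l)⟩, fun y hy => ⟨?_, ?_⟩⟩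
  · have hylast : (M + 1) * y (Fin.last k) < a (Fin.last k) := by
      rw [← hblast, Nat.cast_succ]
      exact (hy (Fin.last k)).2
    exact lt_of_mul_lt_mul_left (hylast.trans_le (ha _).1) hM.le
  · rw [dist_eq_norm]
    refine norm_le_mul_of_forall_abs_le _ fun l => ?_
    have h₁ : (b l : ℝ) ≤ a l := by exact_mod_cast (hba l).1
    have h₂ : (a l : ℝ) ≤ b l + 1 := by exact_mod_cast (hba l).2
    rw [PiLp.sub_apply, le_div_iff₀' hM, ← abs_of_pos hM, ← abs_mul, abs_le, mul_sub]
    constructor <;> linarith [(ha l).1, (ha l).2, (hy l).1, (hy l).2]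

end Cells

section SouthComparison

variable {k M : ℕ}

theorem southLongestEdge_image_range [DecidableEq (EuclideanSpace ℝ (Fin (k + 1)))]
    {x : ℕ → EuclideanSpace ℝ (Fin (k + 1))}
    (hx : Function.Injective fun i => (splitLast (x i)).2) (n : ℕ) :
    southLongestEdge ((Finset.range n).image x) =
      directedLongestEdge (fun j i : Fin n => (splitLast (x j)).2 < (splitLast (x i)).2)
        fun i => x i := by
  have himage : (Finset.range n).image x = Finset.univ.image fun i : Fin n => x i := by
    ext
    simp only [Finset.mem_image, Finset.mem_range, Finset.mem_univ, true_and, Fin.exists_iff,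
      exists_prop]
  have hval : Function.Injective fun i : Fin n => (splitLast (x i)).2 :=
    hx.comp Fin.val_injective
  rw [himage, southLongestEdge_image fun i j h => hval (congrArg (fun y => (splitLast y).2) h)]
  congr! 3 with j i
  rw [lt_iff_le_and_ne, hval.ne_iff, and_comm]
  rfl

theorem markedLongestEdge_le_southLongestEdge [DecidableEq (EuclideanSpace ℝ (Fin (k + 1)))]
    {x : ℕ → EuclideanSpace ℝ (Fin (k + 1))}
    (hx : Function.Injective fun i => (splitLast (x i)).2) (n : ℕ) :
    markedLongestEdge (fun i => splitLast (x i)) n ≤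
      southLongestEdge ((Finset.range n).image x) := by
  rw [southLongestEdge_image_range hx, ← add_zero (directedLongestEdge _ _)]
  exact directedLongestEdge_le_add le_rfl fun i => .inr fun j _ =>
    (dist_fst_splitLast_le _ _).trans (add_zero _).ge

theorem southLongestEdge_le_markedLongestEdge_add
    [DecidableEq (EuclideanSpace ℝ (Fin (k + 1)))] {x : ℕ → EuclideanSpace ℝ (Fin (k + 1))}
    (hx : Function.Injective fun i => (splitLast (x i)).2) (hcube : ∀ i, x i ∈ openCube (k + 1))
    {n : ℕ} (hcell : ∀ c : Fin (k + 1) → Fin (M + 1), ∃ j < n, x j ∈ openCell c) :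
    southLongestEdge ((Finset.range n).image x) ≤
      markedLongestEdge (fun i => splitLast (x i)) n + (k + 1 : ℕ) * (2 / ((M : ℝ) + 1)) := by
  rw [southLongestEdge_image_range hx]
  refine directedLongestEdge_le_add (by positivity) fun i => ?_
  rcases le_or_gt (1 / ((M : ℝ) + 1)) (x i (Fin.last k)) with hhigh | hlow
  · obtain ⟨c, hc⟩ := exists_openCell_below (hcube i) hhigh
    obtain ⟨j, hj, hjc⟩ := hcell c
    exact .inl ⟨⟨j, hj⟩, hc _ hjc⟩
  · refine .inr fun j hji => (dist_le_dist_splitLast_add _ _).trans ?_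
    gcongr
    have hheight : dist (splitLast (x i)).2 (splitLast (x j)).2 ≤ 1 / ((M : ℝ) + 1) := by
      rw [Real.dist_eq, abs_of_pos (sub_pos.2 hji)]
      have hpos : 0 < (splitLast (x j)).2 := (hcube j (Fin.last k)).1
      have hlow' : (splitLast (x i)).2 < 1 / ((M : ℝ) + 1) := hlow
      linarith
    calc dist (splitLast (x i)).2 (splitLast (x j)).2 ≤ 1 * (2 / ((M : ℝ) + 1)) := by
          rw [one_mul]
          exact hheight.trans (by gcongr; norm_num)
      _ ≤ (k + 1 : ℕ) * (2 / ((M : ℝ) + 1)) := by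
          gcongr
          exact_mod_cast k.succ_pos

end SouthComparison

section SouthLimit

variable {k : ℕ}

theorem measurePreserving_infinitePi_comp {α β ι : Type*} [MeasurableSpace α] [MeasurableSpace β]
    {ν : Measure α} {ρ : Measure β} [IsProbabilityMeasure ν] {f : α → β}
    (hf : MeasurePreserving f ν ρ) :
    MeasurePreserving (fun (x : ι → α) i => f (x i)) (Measure.infinitePi fun _ => ν)
      (Measure.infinitePi fun _ => ρ) := by
  have hmeas := hf.measurable
  refine ⟨by fun_prop, ?_⟩
  have h := Measure.infinitePi_map_pi (fun _ : ι => ν) (f := fun _ => f) fun _ => hmeas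
  simpa only [hf.map_eq] using h

instance nullSingletonClass_uniform01 : NullSingletonClass uniform01 := by
  unfold uniform01; infer_instance

theorem ae_uniformSeq_injective_splitLast_snd (k : ℕ) :
    ∀ᵐ x ∂uniformSeq (k + 1), Function.Injective fun i => (splitLast (x i)).2 :=
  have hheight := measurePreserving_infinitePi_comp (ι := ℕ)
    (measurePreserving_snd.comp (measurePreserving_splitLast k))
  hheight.quasiMeasurePreserving.ae ae_injective_infinitePi

theorem measurable_markedLongestEdge_splitLast (k : ℕ) :
    Measurable fun p : ℕ × (ℕ → EuclideanSpace ℝ (Fin (k + 1))) =>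
      markedLongestEdge (fun i => splitLast (p.2 i)) p.1 := by
  have hsplit := measurePreserving_infinitePi_comp (ι := ℕ) (measurePreserving_splitLast k)
  have hmarked : Measurable fun p : ℕ × (ℕ → EuclideanSpace ℝ (Fin k) × ℝ) =>
      markedLongestEdge p.2 p.1 :=
    measurable_from_prod_countable_right measurable_markedLongestEdge
  exact hmarked.comp (measurable_fst.prodMk (hsplit.measurable.comp measurable_snd))

theorem map_markedLongestEdge_poissonSampleLaw (k : ℕ) (r : ℝ≥0) :
    (poissonSampleLaw (k + 1) r).map
        (fun p => markedLongestEdge (fun i => splitLast (p.2 i)) p.1) =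
      (poissonSampleLaw k r).map fun p => ongLongestEdge p.2 p.1 := by
  have hsplit := measurePreserving_infinitePi_comp (ι := ℕ) (measurePreserving_splitLast k)
  refine map_prod_eq_of_ae_map_eq (measurable_markedLongestEdge_splitLast k)
    measurable_ongLongestEdge_uncurry (.of_forall fun n => ?_)
  have h := map_markedLongestEdge (uniformCube k) uniform01 n
  rwa [← hsplit.map_eq, Measure.map_map (measurable_markedLongestEdge n) hsplit.measurable] at h

theorem HasPoissonVoidProbabilities.tendsto_measure_voidEvent {d : ℕ} {ι : Type*} {l : Filter ι}
    {r : ι → ℝ≥0} (hr : Tendsto r l atTop) {Ω : ι → Type*} [∀ i, MeasurableSpace (Ω i)]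
    {μ : ∀ i, Measure (Ω i)} {P : ∀ i, Ω i → Finset (EuclideanSpace ℝ (Fin d))}
    (hP : ∀ i, HasPoissonVoidProbabilities (r i) (P i) (μ i))
    {B : Set (EuclideanSpace ℝ (Fin d))} (hB : MeasurableSet B) (hpos : 0 < uniformCube d B) :
    Tendsto (fun i => μ i (voidEvent (P i) B)) l (𝓝 0) := by
  refine Tendsto.congr (fun i => ((hP i).measure_voidEvent B hB).symm) ?_
  have hB' : 0 < (uniformCube d B).toNNReal :=
    ENNReal.toNNReal_pos hpos.ne' (measure_ne_top _ _)
  have h := (tendsto_poissonMeasure_Iio 1).comp (hr.atTop_mul_const hB')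
  rwa [show Set.Iio 1 = {0} from Set.ext fun _ => Nat.lt_one_iff] at h

open scoped Classical in
theorem tendsto_measure_lt_dist_southLongestEdge_markedLongestEdge {ι : Type*} {l : Filter ι}
    {r : ι → ℝ≥0} (hr : Tendsto r l atTop) {ε : ℝ} (hε : 0 < ε) :
    Tendsto (fun i => poissonSampleLaw (k + 1) (r i)
      {p | ε < dist (southLongestEdge ((Finset.range p.1).image p.2))
        (markedLongestEdge (fun i => splitLast (p.2 i)) p.1)}) l (𝓝 0) := by
  obtain ⟨M, hM⟩ : ∃ M : ℕ, (k + 1 : ℕ) * (2 / ((M : ℝ) + 1)) < ε := by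
    have h := (tendsto_one_div_add_atTop_nhds_zero_nat (𝕜 := ℝ)).const_mul ((k + 1 : ℕ) * 2 : ℝ)
    rw [mul_zero] at h
    refine (h.eventually_lt_const hε).exists.imp fun M hM => ?_
    rwa [mul_assoc, mul_one_div] at hM
  have hvoid := tendsto_finsetSum Finset.univ fun (c : Fin (k + 1) → Fin (M + 1)) _ =>
    HasPoissonVoidProbabilities.tendsto_measure_voidEvent hr
      (fun i => hasPoissonVoidProbabilities_poissonSampleLaw (k + 1) (r i))
      (isOpen_openCell c).measurableSet (uniformCube_openCell_pos c)
  rw [Finset.sum_const_zero] at hvoid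
  refine tendsto_of_tendsto_of_tendsto_of_le_of_le tendsto_const_nhds hvoid
    (fun _ => zero_le) fun i => (measure_mono_ae ?_).trans (measure_iUnion_fintype_le _ _)
  have hae : ∀ᵐ p ∂poissonSampleLaw (k + 1) (r i),
      (Function.Injective fun i => (splitLast (p.2 i)).2) ∧ ∀ i, p.2 i ∈ openCube (k + 1) :=
    measurePreserving_snd.quasiMeasurePreserving.ae
      ((ae_uniformSeq_injective_splitLast_snd k).and (ae_uniformSeq_mem_openCube (k + 1)))
  filter_upwards [hae] with p ⟨hinj, hcube⟩ hlt
  by_contra hall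
  have hcell (c : Fin (k + 1) → Fin (M + 1)) : ∃ j < p.1, p.2 j ∈ openCell c := by
    by_contra! hc
    refine hall (Set.mem_iUnion.2 ⟨c, ?_⟩)
    simpa only [voidEvent, Set.mem_ofPred_eq, Finset.forall_mem_image, Finset.mem_range] using hc
  refine (hlt.trans_le ?_).not_gt hM
  rw [Real.dist_eq, abs_of_nonneg (sub_nonneg.2 (markedLongestEdge_le_southLongestEdge hinj _)),
    sub_le_iff_le_add']
  exact southLongestEdge_le_markedLongestEdge_add hinj hcube hcell

theorem tendstoInDistribution_southLongestEdge {ι : Type*} {l : Filter ι} {r : ι → ℝ≥0}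
    (hr : Tendsto r l atTop) {Ω : ι → Type*} [∀ i, MeasurableSpace (Ω i)]
    {μ : ∀ i, Measure (Ω i)} [∀ i, IsProbabilityMeasure (μ i)]
    {P : ∀ i, Ω i → Finset (EuclideanSpace ℝ (Fin (k + 1)))}
    (hP : ∀ i, HasPoissonVoidProbabilities (r i) (P i) (μ i)) :
    TendstoInDistribution (fun i ω => southLongestEdge (P i ω)) l (fun q : ℝ => q) μ
      (ongSupLaw k : Measure ℝ) := by
  classical
  have hong : TendstoInDistribution
      (fun _ (p : ℕ × (ℕ → EuclideanSpace ℝ (Fin k))) => ongLongestEdge p.2 p.1) l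
      (fun q : ℝ => q) (fun i => poissonSampleLaw k (r i)) (ongSupLaw k : Measure ℝ) := by
    refine tendstoInDistribution_ongLongestEdge
      (fun i => ⟨measurable_snd.aemeasurable, measurePreserving_snd.map_eq⟩)
      (fun i => measurable_fst.aemeasurable) fun m => ?_
    have h (i : ι) : poissonSampleLaw k (r i) {p | p.1 < m} =
        poissonMeasure (r i) (Set.Iio m) :=
      measurePreserving_fst.measure_preimage measurableSet_Iio.nullMeasurableSet
    exact ((tendsto_poissonMeasure_Iio m).comp hr).congr fun i => (h i).symm
  have hmarked := tendstoInDistribution_of_map_eq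
    (fun i => (measurable_markedLongestEdge_splitLast k).aemeasurable) hong
    fun i => map_markedLongestEdge_poissonSampleLaw k (r i)
  have hsample (i : ι) := hasPoissonVoidProbabilities_poissonSampleLaw (k + 1) (r i)
  have hsouth := tendstoInDistribution_of_tendsto_measure_lt_dist
    (fun i => (hsample i).measurable_southLongestEdge.aemeasurable) hmarked
    fun ε => tendsto_measure_lt_dist_southLongestEdge_markedLongestEdge hr
  exact tendstoInDistribution_of_map_eq
    (fun i => (hP i).measurable_southLongestEdge.aemeasurable) hsouth
    fun i => (hP i).map_southLongestEdge_eq (hsample i)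

end SouthLimit

section Coordinates

variable {α : Type*} [MeasurableSpace α] (ν : Measure α) [IsProbabilityMeasure ν]

theorem infinitePi_forall_apply_mem {ι κ : Type*} {s : Finset ι} {σ : ι → κ}
    (hσ : Set.InjOn σ s) {t : ι → Set α} (ht : ∀ i, MeasurableSet (t i)) :
    Measure.infinitePi (fun _ : κ => ν) {y | ∀ i ∈ s, y (σ i) ∈ t i} = ∏ i ∈ s, ν (t i) := by
  classical
  rcases isEmpty_or_nonempty ι with h | h
  · simp [Finset.eq_empty_of_isEmpty s]
  have hinv : Set.LeftInvOn (Function.invFunOn σ s) σ s := hσ.leftInvOn_invFunOn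
  have hset : {y : κ → α | ∀ i ∈ s, y (σ i) ∈ t i} =
      Set.pi (s.image σ : Finset κ) fun j => t (Function.invFunOn σ s j) := by
    ext y
    simp only [Set.mem_ofPred_eq, Finset.coe_image, Set.mem_pi, Set.forall_mem_image]
    exact forall₂_congr fun i hi => by rw [hinv hi]
  rw [hset, Measure.infinitePi_pi _ fun _ _ => ht _, Finset.prod_image hσ]
  exact Finset.prod_congr rfl fun i hi => by rw [hinv hi]

theorem measurePreserving_update_comp_infinitePi {ι κ : Type*} [DecidableEq ι] {n : ι}
    {σ : ι → κ} (hσ : Set.InjOn σ {n}ᶜ) :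
    MeasurePreserving (fun p : (κ → α) × α => Function.update (fun i => p.1 (σ i)) n p.2)
      ((Measure.infinitePi fun _ : κ => ν).prod ν) (Measure.infinitePi fun _ : ι => ν) := by
  have hm : Measurable fun p : (κ → α) × α => Function.update (fun i => p.1 (σ i)) n p.2 := by
    refine measurable_pi_lambda _ fun i => ?_
    rcases eq_or_ne i n with rfl | h
    · simpa only [Function.update_self] using measurable_snd
    · simp only [Function.update_of_ne h]
      fun_prop
  refine ⟨hm, Measure.eq_infinitePi _ fun s t ht => ?_⟩
  have hpre : (fun p : (κ → α) × α => Function.update (fun i => p.1 (σ i)) n p.2) ⁻¹' Set.pi s t =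
      {y | ∀ i ∈ s.erase n, y (σ i) ∈ t i} ×ˢ {a | n ∈ s → a ∈ t n} := by
    ext p
    simp only [Set.mem_preimage, Set.mem_pi, Finset.mem_coe, Set.mem_prod, Set.mem_ofPred_eq,
      Finset.mem_erase]
    grind [Function.update_apply]
  have hinj : Set.InjOn σ (s.erase n : Finset ι) := hσ.mono fun i hi => (Finset.mem_erase.1 hi).1
  rw [Measure.map_apply hm (MeasurableSet.pi s.countable_toSet fun i _ => ht i), hpre,
    Measure.prod_prod, infinitePi_forall_apply_mem ν hinj ht]
  by_cases hn : n ∈ s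
  · simp only [hn, forall_const, Set.ofPred_mem_eq, Finset.prod_erase_mul]
  · simp [hn, Finset.erase_eq_of_notMem]

end Coordinates

section MaxDickman

/-- The random affine-max map `m ↦ max (1 - u) (u m)` of the max-Dickman fixed-point equation,
as a function of the pair `(u, m)`. -/
noncomputable def dickmanStep (p : ℝ × ℝ) : ℝ := max (1 - p.1) (p.1 * p.2)

theorem measurable_dickmanStep : Measurable dickmanStep := by
  unfold dickmanStep; fun_prop

theorem abs_dickmanStep_sub_le {u : ℝ} (hu : 0 ≤ u) (m m' : ℝ) :
    |dickmanStep (u, m) - dickmanStep (u, m')| ≤ u * |m - m'| := by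
  refine (abs_max_sub_max_le_max _ _ _ _).trans (max_le ?_ ?_)
  · rw [sub_self, abs_zero]
    positivity
  · rw [← mul_sub, abs_mul, abs_of_nonneg hu]

theorem ae_uniform01_mem_Ioo : ∀ᵐ u ∂uniform01, u ∈ Set.Ioo (0 : ℝ) 1 :=
  ae_restrict_mem measurableSet_Ioo

theorem integral_uniform01 (g : ℝ → ℝ) : ∫ u, g u ∂uniform01 = ∫ u in (0 : ℝ)..1, g u := by
  rw [uniform01, intervalIntegral.integral_of_le zero_le_one, integral_Ioc_eq_integral_Ioo]

section Uniqueness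

variable {D D' : ProbabilityMeasure ℝ}

theorem IsMaxDickman.measurePreserving_dickmanStep (hD : IsMaxDickman D) :
    MeasurePreserving dickmanStep (uniform01.prod (D : Measure ℝ)) (D : Measure ℝ) :=
  ⟨measurable_dickmanStep, hD⟩

theorem integrable_comp_of_lipschitzWith_of_dist_le {Ω : Type*} [MeasurableSpace Ω]
    {μ : Measure Ω} [IsFiniteMeasure μ] {X : Ω → ℝ} (hX : Measurable X) {f : ℝ → ℝ} {L : ℝ≥0}
    (hf : LipschitzWith L f) {C : ℝ} (hC : ∀ x y, dist (f x) (f y) ≤ C) :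
    Integrable (fun ω => f (X ω)) μ := by
  refine Integrable.of_bound (hf.continuous.measurable.comp hX).aestronglyMeasurable
    (|f 0| + C) (.of_forall fun ω => ?_)
  have htri := dist_triangle (f (X ω)) (f 0) 0
  rw [dist_zero_right, dist_zero_right, Real.norm_eq_abs (f 0)] at htri
  linarith [hC (X ω) 0]

theorem dist_integral_dickmanStep_le {f : ℝ → ℝ} {L : ℝ≥0} (hf : LipschitzWith L f) {C : ℝ}
    (hC : ∀ x y, dist (f x) (f y) ≤ C) (m m' : ℝ) :
    dist (∫ u, f (dickmanStep (u, m)) ∂uniform01) (∫ u, f (dickmanStep (u, m')) ∂uniform01) ≤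
      L / 2 * dist m m' := by
  have hint : ∀ x : ℝ, Integrable (fun u => f (dickmanStep (u, x))) uniform01 := fun x =>
    integrable_comp_of_lipschitzWith_of_dist_le
      (measurable_dickmanStep.comp measurable_prodMk_right) hf hC
  have hmean : ∫ u, u ∂uniform01 = 1 / 2 := by rw [integral_uniform01]; norm_num
  have hid : Integrable (fun u : ℝ => u) uniform01 := by
    refine Integrable.of_bound measurable_id.aestronglyMeasurable 1 ?_
    filter_upwards [ae_uniform01_mem_Ioo] with u hu
    rw [Real.norm_eq_abs, abs_of_pos hu.1]
    exact hu.2.le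
  calc dist (∫ u, f (dickmanStep (u, m)) ∂uniform01) (∫ u, f (dickmanStep (u, m')) ∂uniform01)
      = |∫ u, (f (dickmanStep (u, m)) - f (dickmanStep (u, m'))) ∂uniform01| := by
        rw [Real.dist_eq, integral_sub (hint m) (hint m')]
    _ ≤ ∫ u, |f (dickmanStep (u, m)) - f (dickmanStep (u, m'))| ∂uniform01 :=
        abs_integral_le_integral_abs
    _ ≤ ∫ u, L * (u * |m - m'|) ∂uniform01 := by
        refine integral_mono_ae ((hint m).sub (hint m')).abs ((hid.mul_const _).const_mul _) ?_
        filter_upwards [ae_uniform01_mem_Ioo] with u hu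
        exact (hf.dist_le_mul _ _).trans
          (mul_le_mul_of_nonneg_left (abs_dickmanStep_sub_le hu.1.le m m') L.2)
    _ = L / 2 * dist m m' := by
        rw [integral_const_mul, integral_mul_const, hmean, Real.dist_eq]
        ring

theorem dist_integral_le_of_dist_le {Ω : Type*} [MeasurableSpace Ω] {μ : Measure Ω}
    [IsProbabilityMeasure μ] {f g : Ω → ℝ} (hf : Integrable f μ) (hg : Integrable g μ) {C : ℝ}
    (hC : ∀ ω, dist (f ω) (g ω) ≤ C) : dist (∫ ω, f ω ∂μ) (∫ ω, g ω ∂μ) ≤ C := by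
  rw [dist_eq_norm, ← integral_sub hf hg]
  simpa using norm_integral_le_of_norm_le_const (μ := μ) (f := fun ω => f ω - g ω)
    (.of_forall fun ω => (dist_eq_norm (f ω) (g ω)).symm.trans_le (hC ω))

/-- One step of the max-Dickman recursion replaces `f` by its average, which has the same
oscillation bound and half the Lipschitz constant. -/
theorem exists_lipschitzWith_div_two_pow {f : ℝ → ℝ} {L : ℝ≥0} (hf : LipschitzWith L f) {C : ℝ}
    (hC : ∀ x y, dist (f x) (f y) ≤ C) (n : ℕ) :
    ∃ g : ℝ → ℝ, LipschitzWith (L / 2 ^ n) g ∧ (∀ x y, dist (g x) (g y) ≤ C) ∧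
      ∀ D : ProbabilityMeasure ℝ, IsMaxDickman D →
        ∫ x, g x ∂(D : Measure ℝ) = ∫ x, f x ∂(D : Measure ℝ) := by
  induction n with
  | zero => exact ⟨f, by simpa using hf, hC, fun _ _ => rfl⟩
  | succ n ih =>
    obtain ⟨g, hg, hgC, hgint⟩ := ih
    have hint : ∀ x : ℝ, Integrable (fun u => g (dickmanStep (u, x))) uniform01 := fun x =>
      integrable_comp_of_lipschitzWith_of_dist_le
        (measurable_dickmanStep.comp measurable_prodMk_right) hg hgC
    refine ⟨fun m => ∫ u, g (dickmanStep (u, m)) ∂uniform01,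
      LipschitzWith.of_dist_le_mul fun m m' => ?_,
      fun m m' => dist_integral_le_of_dist_le (hint m) (hint m') fun _ => hgC _ _,
      fun D hD => ?_⟩
    · refine (dist_integral_dickmanStep_le hg hgC m m').trans_eq ?_
      push_cast
      rw [pow_succ, div_div]
    · have hstep := hD.measurePreserving_dickmanStep
      rw [← hgint D hD, ← integral_prod_symm (f := fun p : ℝ × ℝ => g (dickmanStep p))
        (integrable_comp_of_lipschitzWith_of_dist_le hstep.measurable hg hgC)]
      conv_rhs => rw [← hstep.map_eq]
      exact (integral_map hstep.measurable.aemeasurable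
        hg.continuous.measurable.aestronglyMeasurable).symm

theorem IsMaxDickman.integral_eq (hD : IsMaxDickman D) (hD' : IsMaxDickman D') {f : ℝ → ℝ}
    {L : ℝ≥0} (hf : LipschitzWith L f) {C : ℝ} (hC : ∀ x y, dist (f x) (f y) ≤ C) :
    ∫ x, f x ∂(D : Measure ℝ) = ∫ x, f x ∂(D' : Measure ℝ) := by
  choose g hg hgC hgint using exists_lipschitzWith_div_two_pow hf hC
  have hL : Tendsto (fun n => ((L / 2 ^ n : ℝ≥0) : ℝ)) atTop (𝓝 0) := by
    simpa [div_eq_mul_inv] using (tendsto_pow_atTop_nhds_zero_of_lt_one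
      (by norm_num : (0 : ℝ) ≤ 2⁻¹) (by norm_num)).const_mul (L : ℝ)
  have hlim : Tendsto (fun n => ∫ p : ℝ × ℝ, (g n p.1 - g n p.2)
      ∂(D : Measure ℝ).prod (D' : Measure ℝ)) atTop (𝓝 (∫ _ : ℝ × ℝ, (0 : ℝ)
      ∂(D : Measure ℝ).prod (D' : Measure ℝ))) := by
    refine tendsto_integral_of_dominated_convergence (fun _ => C)
      (fun n => ((hg n).continuous.measurable.comp measurable_fst).sub
        ((hg n).continuous.measurable.comp measurable_snd) |>.aestronglyMeasurable)
      (integrable_const _) (fun n => .of_forall fun p => hgC n p.1 p.2)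
      (.of_forall fun p => ?_)
    refine squeeze_zero_norm (fun n => (hg n).dist_le_mul p.1 p.2) ?_
    simpa using hL.mul_const (dist p.1 p.2)
  have heq : ∀ n, ∫ p : ℝ × ℝ, (g n p.1 - g n p.2) ∂(D : Measure ℝ).prod (D' : Measure ℝ) =
      ∫ x, f x ∂(D : Measure ℝ) - ∫ x, f x ∂(D' : Measure ℝ) := fun n => by
    rw [integral_sub (integrable_comp_of_lipschitzWith_of_dist_le measurable_fst (hg n) (hgC n))
      (integrable_comp_of_lipschitzWith_of_dist_le measurable_snd (hg n) (hgC n)),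
      integral_fun_fst, integral_fun_snd, ← hgint n D hD, ← hgint n D' hD']
    simp
  rw [integral_zero] at hlim
  exact sub_eq_zero.1 (tendsto_nhds_unique (tendsto_const_nhds.congr fun n => (heq n).symm) hlim)

theorem IsMaxDickman.eq (hD : IsMaxDickman D) (hD' : IsMaxDickman D') : D = D' := by
  have hlim : Tendsto (fun _ : ℕ => D) atTop (𝓝 D') :=
    tendsto_iff_forall_lipschitz_integral_tendsto.2 fun _ ⟨_, hC⟩ ⟨_, hf⟩ =>
      tendsto_const_nhds.congr fun _ => (hD.integral_eq hD' hf hC).symm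
  exact tendsto_nhds_unique tendsto_const_nhds hlim

end Uniqueness

/-- The perpetuity `sup_n u_0 ⋯ u_{n-1} (1 - u_n)` obtained by unrolling the max-Dickman
recursion along the sequence `u`. -/
noncomputable def dickmanSup (u : ℕ → ℝ) : ℝ := ⨆ n, (∏ i ∈ Finset.range n, u i) * (1 - u n)

theorem measurable_dickmanSup : Measurable dickmanSup :=
  Measurable.iSup fun n => by fun_prop

theorem bddAbove_range_prod_mul_one_sub {u : ℕ → ℝ} (hu : ∀ i, u i ∈ Set.Ioo (0 : ℝ) 1) :
    BddAbove (Set.range fun n => (∏ i ∈ Finset.range n, u i) * (1 - u n)) := by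
  refine ⟨1, ?_⟩
  rintro _ ⟨n, rfl⟩
  exact mul_le_one₀ (Finset.prod_le_one (fun i _ => (hu i).1.le) fun i _ => (hu i).2.le)
    (by linarith [(hu n).2]) (by linarith [(hu n).1])

theorem dickmanSup_eq_dickmanStep {u : ℕ → ℝ} (hu : ∀ i, u i ∈ Set.Ioo (0 : ℝ) 1) :
    dickmanSup u = dickmanStep (u 0, dickmanSup fun n => u (n + 1)) := by
  have hsucc : ∀ n, (∏ i ∈ Finset.range (n + 1), u i) * (1 - u (n + 1)) =
      u 0 * ((∏ i ∈ Finset.range n, u (i + 1)) * (1 - u (n + 1))) := fun n => by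
    rw [Finset.prod_range_succ']; ring
  have hbdd := bddAbove_range_prod_mul_one_sub hu
  have hbdd' : BddAbove (Set.range fun n => u 0 *
      ((∏ i ∈ Finset.range n, u (i + 1)) * (1 - u (n + 1)))) := by
    simp only [← hsucc]
    exact hbdd.mono (Set.range_comp_subset_range (· + 1)
      fun n => (∏ i ∈ Finset.range n, u i) * (1 - u n))
  unfold dickmanSup dickmanStep
  rw [Real.mul_iSup_of_nonneg (hu 0).1.le]
  refine le_antisymm (ciSup_le fun n => ?_) (max_le ?_ (ciSup_le fun n => ?_))
  · cases n with
    | zero => simp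
    | succ n => exact le_max_of_le_right ((hsucc n).trans_le (le_ciSup hbdd' n))
  · simpa using le_ciSup hbdd 0
  · exact (hsucc n).symm.trans_le (le_ciSup hbdd (n + 1))

/-- The law of the max-Dickman perpetuity driven by independent uniform variables. -/
noncomputable def dickmanLaw : ProbabilityMeasure ℝ :=
  ⟨(Measure.infinitePi fun _ : ℕ => uniform01).map dickmanSup,
    Measure.isProbabilityMeasure_map measurable_dickmanSup.aemeasurable⟩

theorem isMaxDickman_dickmanLaw : IsMaxDickman dickmanLaw := by
  have hsup : MeasurePreserving dickmanSup (Measure.infinitePi fun _ : ℕ => uniform01)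
      (dickmanLaw : Measure ℝ) := ⟨measurable_dickmanSup, rfl⟩
  have hcons := (measurePreserving_update_comp_infinitePi uniform01 (n := 0) (σ := Nat.pred)
    fun i hi j hj h => Nat.pred_inj (Nat.pos_of_ne_zero hi) (Nat.pos_of_ne_zero hj) h).comp
      (Measure.measurePreserving_swap (μ := uniform01)
        (ν := Measure.infinitePi fun _ : ℕ => uniform01))
  have hprod := (MeasurePreserving.id uniform01).prod hsup
  change (uniform01.prod (dickmanLaw : Measure ℝ)).map dickmanStep = _
  rw [← hprod.map_eq, Measure.map_map measurable_dickmanStep hprod.measurable,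
    ← (hsup.comp hcons).map_eq]
  refine Measure.map_congr ?_
  filter_upwards [hcons.quasiMeasurePreserving.ae
    (ae_infinitePi_forall_mem ae_uniform01_mem_Ioo)] with p hp
  exact (dickmanSup_eq_dickmanStep hp).symm

theorem existsUnique_isMaxDickman : ∃! D : ProbabilityMeasure ℝ, IsMaxDickman D :=
  ⟨dickmanLaw, isMaxDickman_dickmanLaw, fun _ hD => hD.eq isMaxDickman_dickmanLaw⟩

end MaxDickman

section Records

/-- The record process of `x`: the least of `x 0, …, x n`. -/
noncomputable def runningMin (x : ℕ → ℝ) (n : ℕ) : ℝ :=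
  (Finset.range (n + 1)).inf' Finset.nonempty_range_add_one x

variable {x : ℕ → ℝ} {n : ℕ} {a t : ℝ}

theorem runningMin_le_iff : runningMin x n ≤ a ↔ ∃ j ≤ n, x j ≤ a := by
  simp only [runningMin, Finset.inf'_le_iff, Finset.mem_range, Nat.lt_succ_iff]

theorem runningMin_sub_le_iff : runningMin x n - a ≤ t ↔ ∃ j ≤ n, x j - a ≤ t := by
  simp only [sub_le_iff_le_add, runningMin_le_iff]

theorem le_runningMin_iff : a ≤ runningMin x n ↔ ∀ j ≤ n, a ≤ x j := by
  simp only [runningMin, Finset.le_inf'_iff, Finset.mem_range, Nat.lt_succ_iff]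

theorem runningMin_zero (x : ℕ → ℝ) : runningMin x 0 = x 0 :=
  Finset.inf'_singleton x

theorem runningMin_succ (x : ℕ → ℝ) (n : ℕ) :
    runningMin x (n + 1) = min (runningMin x n) (x (n + 1)) :=
  eq_of_forall_le_iff fun a => by
    simp only [le_inf_iff, le_runningMin_iff, Nat.le_succ_iff_eq_or_le, or_imp, forall_and,
      forall_eq, and_comm]

theorem runningMin_congr {x' : ℕ → ℝ} (h : ∀ j ≤ n, x j = x' j) :
    runningMin x n = runningMin x' n :=
  Finset.inf'_congr _ rfl fun j hj => h j (Nat.lt_succ_iff.1 (Finset.mem_range.1 hj))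

theorem measurable_runningMin (n : ℕ) : Measurable fun x : ℕ → ℝ => runningMin x n := by
  induction n with
  | zero => simpa only [runningMin_zero] using measurable_pi_apply 0
  | succ n ih => simpa only [runningMin_succ] using ih.min (measurable_pi_apply (n + 1))

theorem tendsto_runningMin_zero (hx : ∀ i, 0 ≤ x i) (h : ∀ ε > 0, ∃ i, x i < ε) :
    Tendsto (runningMin x) atTop (𝓝 0) := by
  refine tendsto_order.2 ⟨fun a ha => .of_forall fun n =>
    ha.trans_le (le_runningMin_iff.2 fun j _ => hx j), fun ε hε => ?_⟩
  obtain ⟨i, hi⟩ := h ε hε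
  filter_upwards [eventually_ge_atTop i] with n hn
  exact (runningMin_le_iff.2 ⟨i, hn, le_rfl⟩).trans_lt hi

theorem exists_abs_sub_le_of_apply_zero_le (h : ∀ i ≤ n, 0 < i → ∃ j < i, |x i - x j| ≤ t)
    (h0 : x 0 ≤ a) (hlow : ∃ j ≤ n, a - x j ≤ t) : ∃ j ≤ n, |a - x j| ≤ t := by
  classical
  by_cases hex : ∃ m, m ≤ n ∧ a < x m
  · -- the edge of the first point beyond `a` passes over `a`
    obtain ⟨hmn, ham⟩ := Nat.find_spec hex
    have hpos : 0 < Nat.find hex := by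
      refine Nat.pos_of_ne_zero fun hz => ?_
      rw [hz] at ham
      exact h0.not_gt ham
    obtain ⟨j, hj, hle⟩ := h _ hmn hpos
    have hja : x j ≤ a := not_lt.1 fun hlt => Nat.find_min hex hj ⟨hj.le.trans hmn, hlt⟩
    refine ⟨_, hmn, ?_⟩
    rw [abs_sub_comm, abs_of_pos (sub_pos.2 ham)]
    exact (sub_le_sub_left hja _).trans ((le_abs_self _).trans hle)
  · push Not at hex
    obtain ⟨j, hj, hle⟩ := hlow
    exact ⟨j, hj, (abs_of_nonneg (sub_nonneg.2 (hex j hj))).trans_le hle⟩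

theorem exists_abs_sub_le_iff (h : ∀ i ≤ n, 0 < i → ∃ j < i, |x i - x j| ≤ t) :
    (∃ j ≤ n, |a - x j| ≤ t) ↔ (∃ j ≤ n, x j - a ≤ t) ∧ ∃ j ≤ n, a - x j ≤ t := by
  refine ⟨fun ⟨j, hj, hle⟩ => ⟨⟨j, hj, ?_⟩, ⟨j, hj, (le_abs_self _).trans hle⟩⟩,
    fun ⟨hup, hlow⟩ => ?_⟩
  · rw [← neg_sub]
    exact (neg_le_abs _).trans hle
  · rcases le_total (x 0) a with h0 | h0
    · exact exists_abs_sub_le_of_apply_zero_le h h0 hlow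
    · have hneg := exists_abs_sub_le_of_apply_zero_le (x := fun i => -x i) (a := -a) (t := t)
        (n := n) (by simpa only [neg_sub_neg, abs_sub_comm] using h) (neg_le_neg h0)
        (by simpa only [neg_sub_neg] using hup)
      simpa only [neg_sub_neg, abs_sub_comm] using hneg

end Records

section OneDimensional

theorem norm_eq_abs_apply_zero (v : EuclideanSpace ℝ (Fin 1)) : ‖v‖ = |v 0| := by
  simp [EuclideanSpace.norm_eq, Real.sqrt_sq_eq_abs]

/-- The length of the part of `(0,1)` below all of the points `y 0, …, y n`. -/
noncomputable def lowerRoom (y : ℕ → EuclideanSpace ℝ (Fin 1)) (n : ℕ) : ℝ :=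
  runningMin (fun j => y j 0) n

/-- The length of the part of `(0,1)` above all of the points `y 0, …, y n`. -/
noncomputable def upperRoom (y : ℕ → EuclideanSpace ℝ (Fin 1)) (n : ℕ) : ℝ :=
  runningMin (fun j => 1 - y j 0) n

theorem measurable_lowerRoom (n : ℕ) :
    Measurable fun y : ℕ → EuclideanSpace ℝ (Fin 1) => lowerRoom y n :=
  (measurable_runningMin n).comp (by fun_prop)

theorem measurable_upperRoom (n : ℕ) :
    Measurable fun y : ℕ → EuclideanSpace ℝ (Fin 1) => upperRoom y n :=
  (measurable_runningMin n).comp (by fun_prop)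

variable {y : ℕ → EuclideanSpace ℝ (Fin 1)}

theorem lowerRoom_nonneg (hy : ∀ i, y i ∈ openCube 1) (n : ℕ) : 0 ≤ lowerRoom y n :=
  le_runningMin_iff.2 fun j _ => (hy j 0).1.le

theorem upperRoom_nonneg (hy : ∀ i, y i ∈ openCube 1) (n : ℕ) : 0 ≤ upperRoom y n :=
  le_runningMin_iff.2 fun j _ => sub_nonneg.2 (hy j 0).2.le

theorem lowerRoom_add_upperRoom_le (y : ℕ → EuclideanSpace ℝ (Fin 1)) (n : ℕ) :
    lowerRoom y n + upperRoom y n ≤ 1 := by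
  have hlow : lowerRoom y n ≤ y 0 0 := runningMin_le_iff.2 ⟨0, n.zero_le, le_rfl⟩
  have hup : upperRoom y n ≤ 1 - y 0 0 := runningMin_le_iff.2 ⟨0, n.zero_le, le_rfl⟩
  linarith

theorem ongLongestEdge_congr {d : ℕ} {y y' : ℕ → EuclideanSpace ℝ (Fin d)} {n : ℕ}
    (h : ∀ j < n, y j = y' j) : ongLongestEdge y n = ongLongestEdge y' n := by
  simp only [ongLongestEdge_eq_directedLongestEdge]
  congr 1
  exact funext fun i => h i i.2

theorem upperRoom_sub_le_iff {n : ℕ} {u t : ℝ} :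
    upperRoom y n - (1 - u) ≤ t ↔ ∃ j ≤ n, u - y j 0 ≤ t := by
  simp only [upperRoom, runningMin_sub_le_iff, sub_sub_sub_cancel_left]

/-- A new point in a gap between two old points has an edge no longer than that gap, hence no
longer than an old edge, so only the two outer intervals matter. -/
theorem ongLongestEdge_add_two (y : ℕ → EuclideanSpace ℝ (Fin 1)) (n : ℕ) :
    ongLongestEdge y (n + 2) = max (ongLongestEdge y (n + 1))
      (max (lowerRoom y n - y (n + 1) 0) (upperRoom y n - (1 - y (n + 1) 0))) := by
  have hle {t : ℝ} (ht : 0 ≤ t) : ongLongestEdge y (n + 2) ≤ t ↔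
      max (ongLongestEdge y (n + 1))
        (max (lowerRoom y n - y (n + 1) 0) (upperRoom y n - (1 - y (n + 1) 0))) ≤ t := by
    rw [max_le_iff, max_le_iff, lowerRoom, runningMin_sub_le_iff, upperRoom_sub_le_iff]
    simp only [ongLongestEdge_le_iff y _ ht, norm_eq_abs_apply_zero, PiLp.sub_apply]
    rw [Nat.forall_lt_succ_right]
    simp only [Nat.lt_succ_iff, n.succ_pos, true_imp_iff]
    exact and_congr_right exists_abs_sub_le_iff
  exact le_antisymm ((hle (le_max_of_le_left (ongLongestEdge_nonneg _ _))).2 le_rfl)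
    ((hle (ongLongestEdge_nonneg _ _)).1 le_rfl)

end OneDimensional

section SplitMax

/-- The larger of the two numbers `q.1` and `q.2` scaled by `a` and `b`. For independent
max-Dickman `q.1` and `q.2` it is the longest edge to come from two outer intervals of lengths `a`
and `b`. -/
noncomputable def splitMax (a b : ℝ) (q : ℝ × ℝ) : ℝ := max (a * q.1) (b * q.2)

/-- The longest edge to come from two outer intervals of lengths `a` and `b` if the next point
falls at height `u`: the length of its own edge, or an edge from the remaining intervals. -/
noncomputable def splitStep (a b u : ℝ) (q : ℝ × ℝ) : ℝ :=
  max (max (a - u) (b - (1 - u))) (splitMax (min a u) (min b (1 - u)) q)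

theorem splitMax_swap (a b : ℝ) (q : ℝ × ℝ) : splitMax b a q.swap = splitMax a b q :=
  max_comm _ _

theorem splitStep_swap (a b u : ℝ) (q : ℝ × ℝ) :
    splitStep b a (1 - u) q.swap = splitStep a b u q := by
  simp only [splitStep, splitMax_swap, sub_sub_cancel, max_comm (b - _)]

@[fun_prop]
theorem continuous_splitMax_uncurry : Continuous fun p : ℝ × ℝ × ℝ × ℝ =>
    splitMax p.1 p.2.1 p.2.2 := by
  unfold splitMax; fun_prop

@[fun_prop]
theorem continuous_splitStep_uncurry : Continuous fun p : ℝ × ℝ × ℝ × ℝ × ℝ =>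
    splitStep p.1 p.2.1 p.2.2.1 p.2.2.2 := by
  unfold splitStep splitMax; fun_prop

variable {a b : ℝ} {q : ℝ × ℝ}

theorem splitStep_mul_left (ha : 0 ≤ a) (hb : 0 ≤ b) (hab : a + b ≤ 1) {v : ℝ}
    (hv : v ≤ 1) (hq : 0 ≤ q.2) :
    splitStep a b (a * v) q = splitMax a b (dickmanStep (v, q.1), q.2) := by
  have hav : a * v ≤ a := mul_le_of_le_one_right ha hv
  have hroom : b ≤ 1 - a * v := by linarith
  have hbq : b - (1 - a * v) ≤ b * q.2 := (sub_nonpos.2 hroom).trans (mul_nonneg hb hq)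
  simp only [splitStep, splitMax, dickmanStep, min_eq_right hav, min_eq_left hroom,
    mul_max_of_nonneg _ _ ha, mul_sub, mul_one, mul_assoc]
  rw [max_assoc, max_left_comm (b - _), max_eq_right hbq, max_assoc]

theorem splitStep_of_mem_Icc (ha : 0 ≤ a) (hq : 0 ≤ q.1) {u : ℝ} (hu : u ∈ Set.Icc a (1 - b)) :
    splitStep a b u q = splitMax a b q := by
  have hb : b ≤ 1 - u := by linarith [hu.2]
  have hle : max (a - u) (b - (1 - u)) ≤ a * q.1 :=
    (max_le (sub_nonpos.2 hu.1) (sub_nonpos.2 hb)).trans (mul_nonneg ha hq)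
  rw [splitStep, min_eq_left hu.1, min_eq_left hb]
  exact max_eq_right (hle.trans (le_max_left _ _))

end SplitMax

section SplitLaw

variable {D : ProbabilityMeasure ℝ}

theorem IsMaxDickman.ae_nonneg (hD : IsMaxDickman D) : ∀ᵐ m ∂(D : Measure ℝ), 0 ≤ m := by
  have hstep := hD.measurePreserving_dickmanStep
  rw [← hstep.map_eq, ae_map_iff hstep.measurable.aemeasurable measurableSet_Ici]
  filter_upwards [Measure.quasiMeasurePreserving_fst.ae ae_uniform01_mem_Ioo] with p hp
  exact le_max_of_le_left (sub_nonneg.2 hp.2.le)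

theorem IsMaxDickman.ae_prod_nonneg (hD : IsMaxDickman D) :
    ∀ᵐ q ∂(D : Measure ℝ).prod (D : Measure ℝ), 0 ≤ q.1 ∧ 0 ≤ q.2 :=
  (Measure.quasiMeasurePreserving_fst.ae hD.ae_nonneg).and
    (Measure.quasiMeasurePreserving_snd.ae hD.ae_nonneg)

variable {a b : ℝ} (g : BoundedContinuousFunction ℝ ℝ)

theorem continuous_integral_splitStep (D : ProbabilityMeasure ℝ) (a b : ℝ) :
    Continuous fun u => ∫ q, g (splitStep a b u q) ∂(D : Measure ℝ).prod (D : Measure ℝ) := by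
  refine continuous_of_dominated (fun u => ?_) (fun u => .of_forall fun q => g.norm_coe_le_norm _)
    (integrable_const _) (.of_forall fun q => ?_) <;>
  fun_prop

/-- Rescaling the lower interval to `(0,1)` turns the step into the max-Dickman recursion. -/
theorem IsMaxDickman.integral_splitStep_left (hD : IsMaxDickman D) (ha : 0 ≤ a) (hb : 0 ≤ b)
    (hab : a + b ≤ 1) :
    ∫ u in (0 : ℝ)..a, ∫ q, g (splitStep a b u q) ∂(D : Measure ℝ).prod (D : Measure ℝ) =
      a * ∫ q, g (splitMax a b q) ∂(D : Measure ℝ).prod (D : Measure ℝ) := by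
  have hpres : MeasurePreserving (fun p : ℝ × ℝ × ℝ => (dickmanStep (p.1, p.2.1), p.2.2))
      (uniform01.prod ((D : Measure ℝ).prod (D : Measure ℝ)))
      ((D : Measure ℝ).prod (D : Measure ℝ)) :=
    (hD.measurePreserving_dickmanStep.prod (.id _)).comp
      (measurePreserving_prodAssoc uniform01 (D : Measure ℝ) (D : Measure ℝ)).symm
  have hg : Continuous fun q => g (splitMax a b q) := by fun_prop
  have hstep : ∀ᵐ v ∂uniform01,
      ∫ q, g (splitStep a b (a * v) q) ∂(D : Measure ℝ).prod (D : Measure ℝ) =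
        ∫ q, g (splitMax a b (dickmanStep (v, q.1), q.2))
          ∂(D : Measure ℝ).prod (D : Measure ℝ) := by
    filter_upwards [ae_uniform01_mem_Ioo] with v hv
    refine integral_congr_ae ?_
    filter_upwards [hD.ae_prod_nonneg] with q hq
    rw [splitStep_mul_left ha hb hab hv.2.le hq.2]
  calc ∫ u in (0 : ℝ)..a, ∫ q, g (splitStep a b u q) ∂(D : Measure ℝ).prod (D : Measure ℝ)
      = a * ∫ v in (0 : ℝ)..1,
          ∫ q, g (splitStep a b (a * v) q) ∂(D : Measure ℝ).prod (D : Measure ℝ) := by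
        rw [← smul_eq_mul, intervalIntegral.smul_integral_comp_mul_left (fun u =>
          ∫ q, g (splitStep a b u q) ∂(D : Measure ℝ).prod (D : Measure ℝ)), mul_zero, mul_one]
    _ = a * ∫ v, ∫ q, g (splitMax a b (dickmanStep (v, q.1), q.2))
          ∂(D : Measure ℝ).prod (D : Measure ℝ) ∂uniform01 := by
        rw [← integral_uniform01, integral_congr_ae hstep]
    _ = a * ∫ q, g (splitMax a b q) ∂(D : Measure ℝ).prod (D : Measure ℝ) := by
        rw [← integral_prod (f := fun p : ℝ × ℝ × ℝ => g (splitMax a b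
          (dickmanStep (p.1, p.2.1), p.2.2))) (Integrable.of_bound
            (hg.measurable.comp hpres.measurable).aestronglyMeasurable ‖g‖
            (.of_forall fun _ => g.norm_coe_le_norm _))]
        conv_rhs => rw [← hpres.map_eq]
        rw [integral_map hpres.measurable.aemeasurable hg.aestronglyMeasurable]

theorem IsMaxDickman.integral_splitStep_right (hD : IsMaxDickman D) (ha : 0 ≤ a) (hb : 0 ≤ b)
    (hab : a + b ≤ 1) :
    ∫ u in (1 - b)..1, ∫ q, g (splitStep a b u q) ∂(D : Measure ℝ).prod (D : Measure ℝ) =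
      b * ∫ q, g (splitMax a b q) ∂(D : Measure ℝ).prod (D : Measure ℝ) := by
  have hswap (F : ℝ × ℝ → ℝ) := integral_prod_swap (μ := (D : Measure ℝ)) (ν := (D : Measure ℝ)) F
  have hleft := hD.integral_splitStep_left g hb ha ((add_comm b a).trans_le hab)
  have hreflect := intervalIntegral.integral_comp_sub_left (a := 0) (b := b)
    (fun u => ∫ q, g (splitStep a b u q) ∂(D : Measure ℝ).prod (D : Measure ℝ)) 1
  rw [sub_zero] at hreflect
  simp only [← hswap fun q => g (splitMax b a q), splitMax_swap] at hleft
  rw [← hleft, ← hreflect]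
  refine intervalIntegral.integral_congr fun u _ => ?_
  simp only [← hswap fun q => g (splitStep b a u q), ← splitStep_swap a b (1 - u), sub_sub_cancel]

theorem IsMaxDickman.integral_splitStep_mid (hD : IsMaxDickman D) (ha : 0 ≤ a)
    (hab : a + b ≤ 1) :
    ∫ u in a..(1 - b), ∫ q, g (splitStep a b u q) ∂(D : Measure ℝ).prod (D : Measure ℝ) =
      (1 - b - a) * ∫ q, g (splitMax a b q) ∂(D : Measure ℝ).prod (D : Measure ℝ) := by
  rw [← smul_eq_mul, ← intervalIntegral.integral_const]
  refine intervalIntegral.integral_congr fun u hu => integral_congr_ae ?_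
  rw [Set.uIcc_of_le (by linarith)] at hu
  filter_upwards [hD.ae_prod_nonneg] with q hq
  rw [splitStep_of_mem_Icc ha hq.1 hu]

theorem IsMaxDickman.integral_splitStep (hD : IsMaxDickman D) (ha : 0 ≤ a) (hb : 0 ≤ b)
    (hab : a + b ≤ 1) :
    ∫ u, ∫ q, g (splitStep a b u q) ∂(D : Measure ℝ).prod (D : Measure ℝ) ∂uniform01 =
      ∫ q, g (splitMax a b q) ∂(D : Measure ℝ).prod (D : Measure ℝ) := by
  have hint (s t : ℝ) := (continuous_integral_splitStep g D a b).intervalIntegrable s t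
    (μ := volume)
  rw [integral_uniform01, ← intervalIntegral.integral_add_adjacent_intervals (hint 0 a) (hint a 1),
    ← intervalIntegral.integral_add_adjacent_intervals (hint a (1 - b)) (hint (1 - b) 1),
    hD.integral_splitStep_left g ha hb hab, hD.integral_splitStep_mid g ha hab,
    hD.integral_splitStep_right g ha hb hab]
  ring

end SplitLaw

section Rooms

theorem ae_exists_mem_infinitePi {α : Type*} [MeasurableSpace α] {ν : Measure α}
    [IsProbabilityMeasure ν] {s : Set α} (hs : MeasurableSet s) (hpos : ν s ≠ 0) :
    ∀ᵐ x ∂Measure.infinitePi (fun _ : ℕ => ν), ∃ i, x i ∈ s := by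
  have hlt : ν sᶜ < 1 := by
    rw [prob_compl_eq_one_sub hs]
    exact ENNReal.sub_lt_self ENNReal.one_ne_top one_ne_zero hpos
  have hle (n : ℕ) : Measure.infinitePi (fun _ : ℕ => ν) {x | ¬ ∃ i, x i ∈ s} ≤ ν sᶜ ^ n := by
    calc Measure.infinitePi (fun _ : ℕ => ν) {x | ¬ ∃ i, x i ∈ s}
        ≤ Measure.infinitePi (fun _ : ℕ => ν) (Set.pi (Finset.range n) fun _ => sᶜ) :=
          measure_mono fun x hx i _ => not_exists.1 hx i
      _ = ν sᶜ ^ n := by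
          rw [Measure.infinitePi_pi _ fun _ _ => hs.compl, Finset.prod_const, Finset.card_range]
  exact le_antisymm (ge_of_tendsto' (ENNReal.tendsto_pow_atTop_nhds_zero_of_lt_one hlt) hle)
    zero_le

theorem ae_tendsto_runningMin :
    ∀ᵐ x ∂Measure.infinitePi (fun _ : ℕ => uniform01), Tendsto (runningMin x) atTop (𝓝 0) := by
  have hsmall (m : ℕ) : ∀ᵐ x ∂Measure.infinitePi (fun _ : ℕ => uniform01),
      ∃ i, x i ∈ Set.Iio (1 / ((m : ℝ) + 1)) := by
    refine ae_exists_mem_infinitePi measurableSet_Iio ?_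
    have hsub : Set.Ioo (0 : ℝ) (1 / (m + 1)) ⊆ Set.Iio (1 / ((m : ℝ) + 1)) ∩ Set.Ioo 0 1 :=
      fun u hu => ⟨hu.2, hu.1, hu.2.trans_le (div_le_one_of_le₀ (by simp) (by positivity))⟩
    rw [uniform01, Measure.restrict_apply measurableSet_Iio]
    refine ((?_ : 0 < volume (Set.Ioo (0 : ℝ) (1 / (m + 1)))).trans_le (measure_mono hsub)).ne'
    rw [Real.volume_Ioo, sub_zero]
    exact ENNReal.ofReal_pos.2 (by positivity)
  filter_upwards [ae_all_iff.2 hsmall, ae_infinitePi_forall_mem ae_uniform01_mem_Ioo]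
    with x hx hx01
  refine tendsto_runningMin_zero (fun i => (hx01 i).1.le) fun ε hε => ?_
  obtain ⟨m, hm⟩ := exists_nat_one_div_lt hε
  obtain ⟨i, hi⟩ := hx m
  exact ⟨i, (Set.mem_Iio.1 hi).trans hm⟩

theorem measurePreserving_apply_zero :
    MeasurePreserving (fun x : EuclideanSpace ℝ (Fin 1) => x 0) (uniformCube 1) uniform01 :=
  measurePreserving_snd.comp (measurePreserving_splitLast 0)

theorem measurePreserving_one_sub :
    MeasurePreserving (fun u : ℝ => 1 - u) uniform01 uniform01 := by
  have h := ((volume : Measure ℝ).measurePreserving_sub_left 1).restrict_preimage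
    (measurableSet_Ioo (a := (0 : ℝ)) (b := 1))
  rwa [Set.preimage_const_sub_Ioo, sub_self, sub_zero] at h

theorem ae_tendsto_lowerRoom :
    ∀ᵐ y ∂uniformSeq 1, Tendsto (lowerRoom y) atTop (𝓝 0) :=
  (measurePreserving_infinitePi_comp measurePreserving_apply_zero).quasiMeasurePreserving.ae
    ae_tendsto_runningMin

theorem ae_tendsto_upperRoom :
    ∀ᵐ y ∂uniformSeq 1, Tendsto (upperRoom y) atTop (𝓝 0) :=
  (measurePreserving_infinitePi_comp (measurePreserving_one_sub.comp
    measurePreserving_apply_zero)).quasiMeasurePreserving.ae ae_tendsto_runningMin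

end Rooms

section Completion

/-- The longest edge of the on-line nearest-neighbour graph on `y 0, …, y n` together with edges in
the two outer intervals whose rescaled lengths are `q.1` and `q.2`. For independent max-Dickman
`q.1` and `q.2` its law does not depend on `n`. -/
noncomputable def ongCompletion (n : ℕ) (p : (ℕ → EuclideanSpace ℝ (Fin 1)) × ℝ × ℝ) : ℝ :=
  max (ongLongestEdge p.1 (n + 1)) (splitMax (lowerRoom p.1 n) (upperRoom p.1 n) p.2)

theorem measurable_ongCompletion (n : ℕ) : Measurable (ongCompletion n) := by
  have hedge := measurable_ongLongestEdge (d := 1) (n + 1)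
  have hlow := measurable_lowerRoom n
  have hup := measurable_upperRoom n
  unfold ongCompletion splitMax
  fun_prop

variable {y : ℕ → EuclideanSpace ℝ (Fin 1)}

theorem ongCompletion_zero (hy : y 0 ∈ openCube 1) {q : ℝ × ℝ} (hq : 0 ≤ q.1) :
    ongCompletion 0 (y, q) = splitMax (y 0 0) (1 - y 0 0) q := by
  have hedge : ongLongestEdge y 1 ≤ 0 :=
    (ongLongestEdge_le_iff y 1 le_rfl).2 fun i hi hpos => absurd hi (by lia)
  simp only [ongCompletion, lowerRoom, upperRoom, runningMin_zero]
  exact max_eq_right (hedge.trans (le_max_of_le_left (mul_nonneg (hy 0).1.le hq)))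

theorem ongCompletion_succ_update (y : ℕ → EuclideanSpace ℝ (Fin 1)) (n : ℕ)
    (z : EuclideanSpace ℝ (Fin 1)) (q : ℝ × ℝ) :
    ongCompletion (n + 1) (Function.update y (n + 1) z, q) =
      max (ongLongestEdge y (n + 1)) (splitStep (lowerRoom y n) (upperRoom y n) (z 0) q) := by
  have hupd : ∀ j ≤ n, Function.update y (n + 1) z j = y j := fun j hj =>
    Function.update_of_ne (Nat.lt_succ_of_le hj).ne _ _
  have hedge : ongLongestEdge (Function.update y (n + 1) z) (n + 1) = ongLongestEdge y (n + 1) :=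
    ongLongestEdge_congr fun j hj => hupd j (Nat.le_of_lt_succ hj)
  have hlow : lowerRoom (Function.update y (n + 1) z) n = lowerRoom y n :=
    runningMin_congr fun j hj => by rw [hupd j hj]
  have hup : upperRoom (Function.update y (n + 1) z) n = upperRoom y n :=
    runningMin_congr fun j hj => by rw [hupd j hj]
  have hlow' : lowerRoom (Function.update y (n + 1) z) (n + 1) = min (lowerRoom y n) (z 0) := by
    rw [← hlow, lowerRoom, runningMin_succ, Function.update_self, lowerRoom]
  have hup' : upperRoom (Function.update y (n + 1) z) (n + 1) =
      min (upperRoom y n) (1 - z 0) := by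
    rw [← hup, upperRoom, runningMin_succ, Function.update_self, upperRoom]
  simp only [ongCompletion, ongLongestEdge_add_two, hedge, hlow, hup, hlow', hup',
    Function.update_self, max_assoc, splitStep]

theorem ae_tendsto_ongCompletion (ν : Measure (ℝ × ℝ)) [SFinite ν] :
    ∀ᵐ p ∂(uniformSeq 1).prod ν,
      Tendsto (fun n => ongCompletion n p) atTop (𝓝 (ongSup p.1)) := by
  filter_upwards [Measure.quasiMeasurePreserving_fst.ae (ae_uniformSeq_mem_openCube 1),
    Measure.quasiMeasurePreserving_fst.ae ae_tendsto_lowerRoom,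
    Measure.quasiMeasurePreserving_fst.ae ae_tendsto_upperRoom] with p hcube hlow hup
  have hedge := (tendsto_ongLongestEdge hcube).comp (tendsto_add_atTop_nat 1)
  have hlim := hedge.max ((hlow.mul_const p.2.1).max (hup.mul_const p.2.2))
  have hsup : 0 ≤ ongSup p.1 := Real.iSup_nonneg (ongLongestEdge_nonneg p.1)
  rw [zero_mul, zero_mul, max_self, max_eq_left hsup] at hlim
  exact hlim

variable {D : ProbabilityMeasure ℝ}

theorem IsMaxDickman.integral_ongCompletion_succ_update (hD : IsMaxDickman D)
    (g : BoundedContinuousFunction ℝ ℝ) (hy : ∀ i, y i ∈ openCube 1) (n : ℕ) :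
    ∫ z, ∫ q, g (ongCompletion (n + 1) (Function.update y (n + 1) z, q))
        ∂(D : Measure ℝ).prod (D : Measure ℝ) ∂uniformCube 1 =
      ∫ q, g (ongCompletion n (y, q)) ∂(D : Measure ℝ).prod (D : Measure ℝ) := by
  let h := g.compContinuous ⟨fun x => max (ongLongestEdge y (n + 1)) x, by fun_prop⟩
  have hstep := hD.integral_splitStep h (lowerRoom_nonneg hy n) (upperRoom_nonneg hy n)
    (lowerRoom_add_upperRoom_le y n)
  rw [← measurePreserving_apply_zero.map_eq, integral_map
    measurePreserving_apply_zero.measurable.aemeasurable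
    (continuous_integral_splitStep h D _ _).aestronglyMeasurable] at hstep
  simp only [ongCompletion_succ_update]
  exact hstep

theorem integrable_ongCompletion (g : BoundedContinuousFunction ℝ ℝ) (n : ℕ)
    (ν : Measure (ℝ × ℝ)) [IsFiniteMeasure ν] :
    Integrable (fun p => g (ongCompletion n p)) ((uniformSeq 1).prod ν) :=
  .of_bound (g.continuous.measurable.comp (measurable_ongCompletion n)).aestronglyMeasurable ‖g‖
    (.of_forall fun _ => g.norm_coe_le_norm _)

theorem IsMaxDickman.integral_ongCompletion_succ (hD : IsMaxDickman D)
    (g : BoundedContinuousFunction ℝ ℝ) (n : ℕ) :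
    ∫ p, g (ongCompletion (n + 1) p) ∂(uniformSeq 1).prod ((D : Measure ℝ).prod (D : Measure ℝ)) =
      ∫ p, g (ongCompletion n p)
        ∂(uniformSeq 1).prod ((D : Measure ℝ).prod (D : Measure ℝ)) := by
  have hresample : MeasurePreserving
      (fun p : (ℕ → EuclideanSpace ℝ (Fin 1)) × EuclideanSpace ℝ (Fin 1) =>
        Function.update p.1 (n + 1) p.2) ((uniformSeq 1).prod (uniformCube 1)) (uniformSeq 1) :=
    measurePreserving_update_comp_infinitePi (uniformCube 1) (σ := id) Function.injective_id.injOn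
  let G (y : ℕ → EuclideanSpace ℝ (Fin 1)) : ℝ :=
    ∫ q, g (ongCompletion (n + 1) (y, q)) ∂(D : Measure ℝ).prod (D : Measure ℝ)
  have hG : Integrable G (uniformSeq 1) :=
    (integrable_ongCompletion g (n + 1) ((D : Measure ℝ).prod (D : Measure ℝ))).integral_prod_left
  rw [integral_prod _ (integrable_ongCompletion g _ _),
    integral_prod _ (integrable_ongCompletion g _ _)]
  calc ∫ y, G y ∂uniformSeq 1
      = ∫ p, G (Function.update p.1 (n + 1) p.2) ∂(uniformSeq 1).prod (uniformCube 1) := by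
        conv_lhs => rw [← hresample.map_eq]
        exact integral_map hresample.measurable.aemeasurable
          (hresample.map_eq.symm ▸ hG.aestronglyMeasurable)
    _ = ∫ y, ∫ z, G (Function.update y (n + 1) z) ∂uniformCube 1 ∂uniformSeq 1 :=
        integral_prod _ (hresample.integrable_comp_of_integrable hG)
    _ = ∫ y, ∫ q, g (ongCompletion n (y, q)) ∂(D : Measure ℝ).prod (D : Measure ℝ)
          ∂uniformSeq 1 := by
        refine integral_congr_ae ?_
        filter_upwards [ae_uniformSeq_mem_openCube 1] with y hy
        exact hD.integral_ongCompletion_succ_update g hy n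

theorem IsMaxDickman.integral_ongSupLaw (hD : IsMaxDickman D)
    (g : BoundedContinuousFunction ℝ ℝ) :
    ∫ x, g x ∂(ongSupLaw 1 : Measure ℝ) = ∫ p, g (ongCompletion 0 p)
        ∂(uniformSeq 1).prod ((D : Measure ℝ).prod (D : Measure ℝ)) := by
  have hlim : Tendsto (fun n => ∫ p, g (ongCompletion n p)
      ∂(uniformSeq 1).prod ((D : Measure ℝ).prod (D : Measure ℝ))) atTop
      (𝓝 (∫ p, g (ongSup p.1)
        ∂(uniformSeq 1).prod ((D : Measure ℝ).prod (D : Measure ℝ)))) := by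
    refine tendsto_integral_of_dominated_convergence (fun _ => ‖g‖)
      (fun n => (integrable_ongCompletion g n _).aestronglyMeasurable) (integrable_const _)
      (fun n => .of_forall fun _ => g.norm_coe_le_norm _) ?_
    filter_upwards [ae_tendsto_ongCompletion _] with p hp
    exact (g.continuous.tendsto _).comp hp
  have hconst (n : ℕ) : ∫ p, g (ongCompletion n p)
      ∂(uniformSeq 1).prod ((D : Measure ℝ).prod (D : Measure ℝ)) = ∫ p, g (ongCompletion 0 p)
        ∂(uniformSeq 1).prod ((D : Measure ℝ).prod (D : Measure ℝ)) := by
    induction n with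
    | zero => rfl
    | succ n ih => rw [hD.integral_ongCompletion_succ, ih]
  rw [← tendsto_nhds_unique hlim (tendsto_const_nhds.congr fun n => (hconst n).symm),
    integral_fun_fst (fun y => g (ongSup y)), probReal_univ, one_smul]
  exact integral_map measurable_ongSup.aemeasurable g.continuous.aestronglyMeasurable

theorem IsMaxDickman.ongSupLaw_eq (hD : IsMaxDickman D) :
    (ongSupLaw 1 : Measure ℝ) = (uniform01.prod ((D : Measure ℝ).prod (D : Measure ℝ))).map
      fun p : ℝ × ℝ × ℝ => max (p.1 * p.2.1) ((1 - p.1) * p.2.2) := by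
  have happly : MeasurePreserving (fun y : ℕ → EuclideanSpace ℝ (Fin 1) => y 0 0) (uniformSeq 1)
      uniform01 :=
    measurePreserving_apply_zero.comp (measurePreserving_eval_infinitePi _ 0)
  have hfirst : MeasurePreserving
      (fun p : (ℕ → EuclideanSpace ℝ (Fin 1)) × ℝ × ℝ => (p.1 0 0, p.2))
      ((uniformSeq 1).prod ((D : Measure ℝ).prod (D : Measure ℝ)))
      (uniform01.prod ((D : Measure ℝ).prod (D : Measure ℝ))) :=
    happly.prod (.id _)
  have hsplit : Measurable fun p : ℝ × ℝ × ℝ => max (p.1 * p.2.1) ((1 - p.1) * p.2.2) := by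
    fun_prop
  have := Measure.isProbabilityMeasure_map hsplit.aemeasurable
    (μ := uniform01.prod ((D : Measure ℝ).prod (D : Measure ℝ)))
  refine ext_of_forall_integral_eq_of_IsFiniteMeasure fun g => ?_
  rw [hD.integral_ongSupLaw g, ← hfirst.map_eq, Measure.map_map hsplit hfirst.measurable,
    integral_map (hsplit.comp hfirst.measurable).aemeasurable
      g.continuous.aestronglyMeasurable]
  refine integral_congr_ae ?_
  filter_upwards [Measure.quasiMeasurePreserving_fst.ae (ae_uniformSeq_mem_openCube 1),
    Measure.quasiMeasurePreserving_snd.ae hD.ae_prod_nonneg] with p hcube hq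
  rw [ongCompletion_zero (hcube 0) hq.1]
  rfl

end Completion

section RandomSampleSize

variable {k : ℕ} {ι Ω : Type*} {l : Filter ι} [MeasurableSpace Ω] {μ : Measure Ω}
  {N : ι → Ω → ℕ}

theorem tendsto_measure_lt_of_hasLaw_poissonMeasure {r : ι → ℝ≥0} (hr : Tendsto r l atTop)
    (hN : ∀ i, HasLaw (N i) (poissonMeasure (r i)) μ) (m : ℕ) :
    Tendsto (fun i => μ {ω | N i ω < m}) l (𝓝 0) := by
  refine ((tendsto_poissonMeasure_Iio m).comp hr).congr fun i => ?_
  rw [Function.comp_apply, ← (hN i).map_eq,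
    Measure.map_apply_of_aemeasurable (hN i).aemeasurable measurableSet_Iio]
  rfl

variable [IsProbabilityMeasure μ] {U : ℕ → Ω → EuclideanSpace ℝ (Fin k)}

theorem tendstoInDistribution_ongLongestEdge_of_iIndepFun
    (hU : ∀ j, HasLaw (U j) (uniformCube k) μ) (hind : iIndepFun U μ)
    (hNm : ∀ i, AEMeasurable (N i) μ)
    (hN : ∀ m, Tendsto (fun i => μ {ω | N i ω < m}) l (𝓝 0)) :
    TendstoInDistribution (fun i ω => ongLongestEdge (fun j => U j ω) (N i ω)) l
      (fun q : ℝ => q) (fun _ => μ) (ongSupLaw k : Measure ℝ) :=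
  tendstoInDistribution_ongLongestEdge
    (fun _ => hind.hasLaw_infinitePi hU (aemeasurable_pi_iff.2 fun j => (hU j).aemeasurable))
    hNm hN

theorem tendstoInDistribution_ongLongestEdge_atTop
    (hU : ∀ j, HasLaw (U j) (uniformCube k) μ) (hind : iIndepFun U μ) :
    TendstoInDistribution (fun (n : ℕ) ω => ongLongestEdge (fun j => U j ω) n) atTop
      (fun q : ℝ => q) (fun _ => μ) (ongSupLaw k : Measure ℝ) := by
  refine tendstoInDistribution_ongLongestEdge_of_iIndepFun hU hind
    (fun _ => aemeasurable_const) fun m => tendsto_const_nhds.congr' ?_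
  filter_upwards [eventually_ge_atTop m] with n hn
  simp [hn.not_gt]

end RandomSampleSize

end SouthMDST

open SouthMDST in
theorem theorem3_general (k : ℕ) :
    ∃ Q : ProbabilityMeasure ℝ,
      (∀ {ι : Type*} (l : Filter ι) (r : ι → ℝ≥0), Tendsto r l atTop →
        ∀ {Ω : ι → Type*} [∀ i, MeasurableSpace (Ω i)] (μ : ∀ i, Measure (Ω i))
          [∀ i, IsProbabilityMeasure (μ i)]
          (P : ∀ i, Ω i → Finset (EuclideanSpace ℝ (Fin (k + 1)))),
          (∀ i, HasPoissonVoidProbabilities (r i) (P i) (μ i)) →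
            TendstoInDistribution (fun i ω => southLongestEdge (P i ω)) l
              (fun q : ℝ => q) μ (Q : Measure ℝ)) ∧
      (∀ {Ω : Type*} [MeasurableSpace Ω] (μ : Measure Ω) [IsProbabilityMeasure μ]
          (U : ℕ → Ω → EuclideanSpace ℝ (Fin k)),
          (∀ j, HasLaw (U j) (uniformCube k) μ) → iIndepFun U μ →
            TendstoInDistribution (fun (n : ℕ) ω => ongLongestEdge (fun j => U j ω) n) atTop
              (fun q : ℝ => q) (fun _ => μ) (Q : Measure ℝ)) ∧
      (∀ {ι : Type*} (l : Filter ι) {Ω : Type*} [MeasurableSpace Ω] (μ : Measure Ω)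
          [IsProbabilityMeasure μ] (U : ℕ → Ω → EuclideanSpace ℝ (Fin k)) (N : ι → Ω → ℕ),
          (∀ j, HasLaw (U j) (uniformCube k) μ) → iIndepFun U μ →
          (∀ i, AEMeasurable (N i) μ) →
          (∀ m, Tendsto (fun i => μ {ω | N i ω < m}) l (𝓝 0)) →
            TendstoInDistribution (fun i ω => ongLongestEdge (fun j => U j ω) (N i ω)) l
              (fun q : ℝ => q) (fun _ => μ) (Q : Measure ℝ)) ∧
      (k = 1 →
        (∃! D : ProbabilityMeasure ℝ, IsMaxDickman D) ∧
        ∀ D : ProbabilityMeasure ℝ, IsMaxDickman D →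
          (Q : Measure ℝ) =
            (uniform01.prod ((D : Measure ℝ).prod (D : Measure ℝ))).map
              (fun p : ℝ × ℝ × ℝ => max (p.1 * p.2.1) ((1 - p.1) * p.2.2))) := by
  refine ⟨ongSupLaw k, fun _ _ hr _ _ _ _ _ hP => tendstoInDistribution_southLongestEdge hr hP,
    fun _ _ _ hU hind => tendstoInDistribution_ongLongestEdge_atTop hU hind,
    fun _ _ _ _ _ _ _ hU hind hNm hN =>
      tendstoInDistribution_ongLongestEdge_of_iIndepFun hU hind hNm hN, ?_⟩
  rintro rfl
  exact ⟨existsUnique_isMaxDickman, fun _ hD => hD.ongSupLaw_eq⟩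

open SouthMDST in
/-- The ambient dimension is `k + 1 ≥ 2`, and `Q` is the law of `Q_max(k)`. -/
theorem theorem3 (k : ℕ) (hk : 1 ≤ k) :
    ∃ Q : ProbabilityMeasure ℝ,
      -- the longest edge of the South MDST on a Poisson process in `(0,1)^(k+1)`, as the
      -- intensity tends to infinity
      (∀ {ι : Type*} (l : Filter ι) (r : ι → ℝ≥0), Tendsto r l atTop →
        ∀ {Ω : ι → Type*} [∀ i, MeasurableSpace (Ω i)] (μ : ∀ i, Measure (Ω i))
          [∀ i, IsProbabilityMeasure (μ i)]
          (P : ∀ i, Ω i → Finset (EuclideanSpace ℝ (Fin (k + 1)))),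
          (∀ i, IsPoissonProcess (r i) (P i) (μ i)) →
            TendstoInDistribution (fun i ω => southLongestEdge (P i ω)) l
              (fun q : ℝ => q) μ (Q : Measure ℝ)) ∧
      -- the longest edge of the ONG on `n` independent uniform points in `(0,1)^k`
      (∀ {Ω : Type*} [MeasurableSpace Ω] (μ : Measure Ω) [IsProbabilityMeasure μ]
          (U : ℕ → Ω → EuclideanSpace ℝ (Fin k)),
          (∀ j, HasLaw (U j) (uniformCube k) μ) → iIndepFun U μ →
            TendstoInDistribution (fun (n : ℕ) ω => ongLongestEdge (fun j => U j ω) n) atTop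
              (fun q : ℝ => q) (fun _ => μ) (Q : Measure ℝ)) ∧
      -- the longest edge of the ONG on a Poisson number of independent uniform points
      (∀ {ι : Type*} (l : Filter ι) (r : ι → ℝ≥0), Tendsto r l atTop →
        ∀ {Ω : Type*} [MeasurableSpace Ω] (μ : Measure Ω) [IsProbabilityMeasure μ]
          (U : ℕ → Ω → EuclideanSpace ℝ (Fin k)) (N : ι → Ω → ℕ),
          (∀ j, HasLaw (U j) (uniformCube k) μ) → iIndepFun U μ →
          (∀ i, HasLaw (N i) (poissonMeasure (r i)) μ) →
          (∀ i, IndepFun (N i) (fun ω j => U j ω) μ) →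
            TendstoInDistribution (fun i ω => ongLongestEdge (fun j => U j ω) (N i ω)) l
              (fun q : ℝ => q) (fun _ => μ) (Q : Measure ℝ)) ∧
      -- ambient dimension two: `Q` is the law of `max {U M₁, (1 - U) M₂}`
      (k = 1 →
        (∃! D : ProbabilityMeasure ℝ, IsMaxDickman D) ∧
        ∀ D : ProbabilityMeasure ℝ, IsMaxDickman D →
          (Q : Measure ℝ) =
            (uniform01.prod ((D : Measure ℝ).prod (D : Measure ℝ))).map
              (fun p : ℝ × ℝ × ℝ => max (p.1 * p.2.1) ((1 - p.1) * p.2.2))) := by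
  obtain ⟨Q, hSouth, hOng, hOngRandom, hDickman⟩ := theorem3_general k
  exact ⟨Q, fun l r hr _ _ μ _ P hP =>
    hSouth l r hr μ P fun i => (hP i).hasPoissonVoidProbabilities, hOng,
    fun l r hr _ _ μ _ U N hU hind hN _ => hOngRandom l μ U N hU hind (fun i => (hN i).aemeasurable)
      (tendsto_measure_lt_of_hasLaw_poissonMeasure hr hN), hDickman⟩
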